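/- **Setting.** Let $\mathcal N$ be the set of all sequences $\bar n=\langle n^0_m,n^1_m:m<\omega\rangle$ of natural numbers such that $4<n^0_m\le n^1_m<n^0_{m+1}$ for all $m$, $2^{2(M+2)}\sum_{m<M}n^0_m n^1_m<n^0_M$ for all $M<\omega$, and $\lim_{m\to\infty}(n^1_m)^{1/(2n^0_m)}=\infty$. Let $\mathbf H$ assign to each $i<\omega$ a countable set $\mathbf H(i)$ with at least two elements; $\prod_i\mathbf H(i)$ carries the product of the discrete topologies. For $\bar n\in\mathcal N$, $Q^{\mathbf H}_{\bar n}$ is the set of all sequences $p=(w,\sigma_0,\sigma_1,\dots)$ of finite functions with pairwise disjoint domains, $w\in\prod_{i\in\mathrm{dom}(w)}\mathbf H(i)$, $\sigma_j\in\prod_{i\in\mathrm{dom}(\sigma_j)}\mathbf H(i)$, such that for some $m^*<\omega$ there is a partition $\langle V_m:m^*\le m<\omega\rangle$ of $\omega$ (empty pieces allowed) with $|V_m|\le n^1_m 2^{m^*}$ and $|\mathrm{dom}(\sigma_j)|\ge n^0_m/2^{m^*}$ for all $m\ge m^*$, $j\in V_m$. Put $\mathrm{POS}(p)=\{\eta\in\prod_i\mathbf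 H(i): w\subseteq\eta \text{ and } \sigma_j\not\subseteq\eta\text{ for all }j\}$ and $\mathcal C=\mathcal C^{\mathbf H}_{\bar n}=\{\mathrm{POS}(p):p\in Q^{\mathbf H}_{\bar n}\}$. A family $\mathcal C$ of subsets of $\mathcal Y$ is a *category base* on $\mathcal Y$ if $\mathcal Y=\bigcup\mathcal C$ and, for every $\mathcal D\subseteq\mathcal C$ consisting of pairwise disjoint sets with $0<|\mathcal D|<|\mathcal C|$ and every $A\in\mathcal C$: if some $B\in\mathcal C$ satisfies $B\subseteq A\cap\bigcup\mathcal D$, then some $B\in\mathcal C$ satisfies $B\subseteq A\cap D$ for some $D\in\mathcal D$; and if no $B\in\mathcal C$ satisfies $B\subseteq A\cap\bigcup\mathcal D$, then some $B\in\mathcal C$ satisfies $B\subseteq A\setminus\bigcup\mathcal D$. A set $S$ is *$\mathcal C$-singular* if every $A\in\mathcal C$ has a subset $B\in\mathcal C$ with $B\cap S=\emptyset$; it is *$\mathcal C$-meager* (in symbols, $S\in\mathcal M_{\mathcal C}$) if it is covered by countably many $\mathcal C$-singular sets; it has the *$\mathcal C$-Baire property* if every $A\in\mathcal C$ has a subset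 $B\in\mathcal C$ such that $B\cap S$ or $B\setminus S$ is $\mathcal C$-meager. A (proper) $\sigma$-ideal $\mathcal I$ on a Polish space is *Borel* if each member is contained in a Borel member, and *ccc* if the Boolean algebra of Borel sets modulo $\mathcal I$ satisfies the countable chain condition. An ideal $\mathcal I$ on $\mathcal X^\omega$ is *index-invariant* if $\{x\in\mathcal X^\omega:x\circ\pi\in A\}\in\mathcal I$ for all $A\in\mathcal I$ and all injections $\pi:\omega\to\omega$; for a group $\mathcal X$ it is *translation-invariant* if it is closed under all (left and right) translations of the product group $\mathcal X^\omega$. **Statement.** Let $\bar n\in\mathcal N$ and let $\mathbf H$ be as above. 1. $\mathcal C^{\mathbf H}_{\bar n}$ is a category base on $\prod_i\mathbf H(i)$, and no member of $\mathcal C^{\mathbf H}_{\bar n}$ is $\mathcal C^{\mathbf H}_{\bar n}$-meager. 2. Every $\mathbf\Sigma^1_1$ (analytic) subset of $\prod_i\mathbf H(i)$ has the $\mathcal C^{\mathbf H}_{\bar n}$-Baire property. For every $A\subseteq\prod_i\mathbf H(i)$ with the $\mathcal C^{\mathbf H}_{\bar n}$-Baire property there is a $\mathbf\Pi^0_3$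 set $B\subseteq A$ such that $A\setminus B$ is $\mathcal C^{\mathbf H}_{\bar n}$-meager. 3. $\mathcal M_{\mathcal C^{\mathbf H}_{\bar n}}$ is a Borel ccc $\sigma$-ideal; in fact each of its members is contained in a $\mathbf\Sigma^0_3$ member. 4. Suppose that $\mathbf H(i)=\mathcal X$ for all $i$, where $\mathcal X$ is a finite group with at least two elements. Then $\mathcal M_{\mathcal C^{\mathbf H}_{\bar n}}$ is a Borel ccc translation-invariant index-invariant $\sigma$-ideal of subsets of $\mathcal X^\omega$ which is neither the ideal of meager sets, nor the ideal of null sets (for the product of the uniform measures on $\mathcal X$), nor their intersection. Moreover, relative to any enumeration of the finite set $\mathcal X$, the formula "$r\in\omega^\omega$ is a Borel code for a subset of $\mathcal X^\omega$, and the set coded by $r$ is in $\mathcal M_{\mathcal C^{\mathbf H}_{\bar n}}$" is $\Sigma^1_2$ with parameter $\bar n$: there is an arithmetical relation $S$ between elements of $\omega^\omega$, depending only on $\mathcal X$ and its enumeration, such that for all $\bar n\in\mathcal N$ and $r\in\omega^\omega$ the formula holds if and only if $(\exists x\in\omega^\omega)(\forall y\in\omega^\omega)\,S(n^0,n^1,r,x,y)$.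 -/

import Mathlib

open Set Filter Topology MeasureTheory

universe u v

namespace NormIdeal

/-! ## The forcing conditions and their sets of possibilities -/

/-- The set `𝒩` of pairs of sequences `n̄ = ⟨n⁰_m, n¹_m : m < ω⟩`. -/
structure IsNormSeq (n₀ n₁ : ℕ → ℕ) : Prop where
  four_lt : ∀ m, 4 < n₀ m
  le : ∀ m, n₀ m ≤ n₁ m
  lt_succ : ∀ m, n₁ m < n₀ (m + 1)
  sum_lt : ∀ M, 2 ^ (2 * (M + 2)) * ∑ m ∈ Finset.range M, n₀ m * n₁ m < n₀ M
  tendsto : Tendsto (fun m => (n₁ m : ℝ) ^ (1 / (2 * (n₀ m : ℝ)))) atTop atTop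

/-- A finite partial function: an element of `∏_{i ∈ dom} H i` for a finite set `dom ⊆ ω`. -/
structure FinFun (H : ℕ → Type u) where
  dom : Finset ℕ
  val : ∀ i : dom, H i

/-- The finite partial function `s` is contained in the total function `η`. -/
def FinFun.Sub {H : ℕ → Type u} (s : FinFun H) (η : ∀ i, H i) : Prop :=
  ∀ i : s.dom, η i = s.val i

/-- The conditions `(w, σ₀, σ₁, …)` of the forcing notion `Q^H_n̄`. In `norm`, the sets `V m`
for `m ≥ M` form a partition of `ω` (empty pieces are allowed). -/
structure Cond (n₀ n₁ : ℕ → ℕ) (H : ℕ → Type u) where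
  w : FinFun H
  σ : ℕ → FinFun H
  disjoint_w : ∀ j, Disjoint w.dom (σ j).dom
  disjoint_σ : ∀ i j, i ≠ j → Disjoint (σ i).dom (σ j).dom
  norm : ∃ (M : ℕ) (V : ℕ → Finset ℕ),
    (∀ j, ∃! m, M ≤ m ∧ j ∈ V m) ∧
    ∀ m, M ≤ m → (V m).card ≤ n₁ m * 2 ^ M ∧
      ∀ j ∈ V m, (n₀ m : ℝ) / 2 ^ M ≤ ((σ j).dom.card : ℝ)

/-- `POS(p)`. -/
def Cond.pos {n₀ n₁ : ℕ → ℕ} {H : ℕ → Type u} (p : Cond n₀ n₁ H) : Set (∀ i, H i) :=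
  {η | p.w.Sub η ∧ ∀ j, ¬ (p.σ j).Sub η}

/-- The family `{POS(p) : p ∈ Q^H_n̄}`. -/
def posFamily (n₀ n₁ : ℕ → ℕ) (H : ℕ → Type u) : Set (Set (∀ i, H i)) :=
  Set.range (fun p : Cond n₀ n₁ H => p.pos)

/-! ## Category bases -/

section CategoryBase

variable {X : Type u}

/-- `C` is a category base on `X` (Morgan). -/
structure IsCategoryBase (C : Set (Set X)) : Prop where
  sUnion_eq : ⋃₀ C = univ
  exists_of_subset : ∀ D ⊆ C, D.PairwiseDisjoint id → 0 < Cardinal.mk D →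
    Cardinal.mk D < Cardinal.mk C → ∀ A ∈ C,
      (∃ B ∈ C, B ⊆ A ∩ ⋃₀ D) → ∃ E ∈ D, ∃ B ∈ C, B ⊆ A ∩ E
  exists_of_not_subset : ∀ D ⊆ C, D.PairwiseDisjoint id → 0 < Cardinal.mk D →
    Cardinal.mk D < Cardinal.mk C → ∀ A ∈ C,
      (¬ ∃ B ∈ C, B ⊆ A ∩ ⋃₀ D) → ∃ B ∈ C, B ⊆ A \ ⋃₀ D

/-- `C`-singular sets. -/
def IsSingularSet (C : Set (Set X)) (S : Set X) : Prop :=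
  ∀ A ∈ C, ∃ B ∈ C, B ⊆ A \ S

/-- The family of `C`-meager sets: those covered by countably many `C`-singular sets. -/
def meagerIdeal (C : Set (Set X)) : Set (Set X) :=
  {S | ∃ T : ℕ → Set X, (∀ n, IsSingularSet C (T n)) ∧ S ⊆ ⋃ n, T n}

/-- The family of sets with the `C`-Baire property. -/
def baireSets (C : Set (Set X)) : Set (Set X) :=
  {S | ∀ A ∈ C, ∃ B ∈ C, B ⊆ A ∧ (B ∩ S ∈ meagerIdeal C ∨ B \ S ∈ meagerIdeal C)}

end CategoryBase

/-! ## Ideals on topological spaces and on product groups -/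

section Ideals

variable {X : Type u}

/-- (Proper) `σ`-ideals of subsets of `X`. -/
structure IsSigmaIdeal (I : Set (Set X)) : Prop where
  empty_mem : ∅ ∈ I
  mono : ∀ A B, A ⊆ B → B ∈ I → A ∈ I
  iUnion_mem : ∀ A : ℕ → Set X, (∀ n, A n ∈ I) → (⋃ n, A n) ∈ I
  univ_notMem : univ ∉ I

/-- The ideal has a Borel basis. -/
def HasBorelBasis [TopologicalSpace X] (I : Set (Set X)) : Prop :=
  ∀ A ∈ I, ∃ B ∈ I, MeasurableSet[borel X] B ∧ A ⊆ B

/-- The quotient algebra of Borel sets modulo `I` satisfies the ccc: a family of Borel sets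
representing an antichain of non-zero elements of the quotient is countable. -/
def IsCCC [TopologicalSpace X] (I : Set (Set X)) : Prop :=
  ∀ F : Set (Set X), (∀ A ∈ F, MeasurableSet[borel X] A ∧ A ∉ I) →
    F.Pairwise (fun A B => A ∩ B ∈ I) → F.Countable

/-- The (boldface) additive Borel classes of finite level, `sigmaZero n` being `Σ⁰_n`:
`Σ⁰_1` consists of the open sets and `Σ⁰_{n+1}` of the countable unions of `Π⁰_n` sets
(in a metrizable space).  The value at `n = 0` is a dummy. -/
def sigmaZero (X : Type u) [TopologicalSpace X] : ℕ → Set (Set X)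
  | 0 => ∅
  | 1 => {A | IsOpen A}
  | n + 2 => {A | ∃ F : ℕ → Set X, (∀ k, (F k)ᶜ ∈ sigmaZero X (n + 1)) ∧ A = ⋃ k, F k}

/-- The (boldface) multiplicative Borel classes `Π⁰_n`. -/
def piZero (X : Type u) [TopologicalSpace X] (n : ℕ) : Set (Set X) :=
  {A | Aᶜ ∈ sigmaZero X n}

/-- Translation invariance, on both sides (the two agree in a commutative group). -/
def IsTranslationInvariant [AddGroup X] (I : Set (Set X)) : Prop :=
  ∀ x : X, ∀ A ∈ I, (fun a => a + x) '' A ∈ I ∧ (fun a => x + a) '' A ∈ I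

/-- Index invariance of a family of subsets of `X^ω`. -/
def IsIndexInvariant (I : Set (Set (ℕ → X))) : Prop :=
  ∀ π : ℕ → ℕ, Function.Injective π → ∀ A ∈ I, {x : ℕ → X | x ∘ π ∈ A} ∈ I

/-- The ideal of topologically meager (first category) sets. -/
def firstCategoryIdeal (X : Type u) [TopologicalSpace X] : Set (Set X) :=
  {A | IsMeagre A}

/-- The ideal of null subsets of `X^ω`, for the product of the uniform probability measures
on the finite set `X`. -/
noncomputable def nullIdeal (X : Type u) [Fintype X] [Nonempty X] : Set (Set (ℕ → X)) :=
  letI : MeasurableSpace X := ⊤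
  {A | Measure.infinitePi (fun _ : ℕ => (PMF.uniformOfFintype X).toMeasure) A = 0}

end Ideals

/-! ## Borel codes and `Σ¹_2` formulas -/

section Codes

variable {X : Type u} {k : ℕ}

/-- The `n`-th basic clopen subset of `X^ω`, for a finite set `X` enumerated by `e`: the
number `n` codes a finite sequence of numbers, which is read as a finite sequence of elements
of `X` (if it has an entry `≥ k`, the basic set is empty). -/
def basicClopen (e : X ≃ Fin k) (n : ℕ) : Set (ℕ → X) :=
  {x | ∀ (i : ℕ) (h : i < (Denumerable.ofNat (List ℕ) n).length),
    (e (x i) : ℕ) = (Denumerable.ofNat (List ℕ) n)[i]}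

/-- `IsBorelCode e r A` says that the real `r` is a Borel code, and that the subset of `X^ω`
coded by `r` is `A` (Solovay's coding): `r` codes an open set if `2 ≤ r 0`, the complement of a
coded set if `r 0 = 0`, and the union of countably many coded sets if `r 0 = 1`. -/
inductive IsBorelCode (e : X ≃ Fin k) : (ℕ → ℕ) → Set (ℕ → X) → Prop
  | basic (r : ℕ → ℕ) (h : 2 ≤ r 0) :
      IsBorelCode e r (⋃ n ∈ {n : ℕ | r (n + 1) = 1}, basicClopen e n)
  | compl (r : ℕ → ℕ) (h : r 0 = 0) (A : Set (ℕ → X))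
      (hA : IsBorelCode e (fun n => r (n + 1)) A) : IsBorelCode e r Aᶜ
  | union (r : ℕ → ℕ) (h : r 0 = 1) (A : ℕ → Set (ℕ → X))
      (hA : ∀ i, IsBorelCode e (fun n => r (Nat.pair i n + 1)) (A i)) :
      IsBorelCode e r (⋃ i, A i)

/-- Arithmetical relations between `k` reals (elements of `ω^ω`) and `l` natural numbers: those
defined by a formula with quantifiers over natural numbers only, whose atomic formulas are
primitive recursive relations between numbers, and `f(a) = b` for a real `f` and numbers
`a, b`. -/
inductive IsArithmetical {k : ℕ} : (l : ℕ) → ((Fin k → ℕ → ℕ) → (Fin l → ℕ) → Prop) → Prop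
  | primrec {l : ℕ} (P : (Fin l → ℕ) → Prop) (hP : PrimrecPred P) :
      IsArithmetical l (fun _ v => P v)
  | app {l : ℕ} (i : Fin k) (a b : Fin l) : IsArithmetical l (fun f v => f i (v a) = v b)
  | not {l : ℕ} {R : (Fin k → ℕ → ℕ) → (Fin l → ℕ) → Prop} (hR : IsArithmetical l R) :
      IsArithmetical l (fun f v => ¬ R f v)
  | and {l : ℕ} {R S : (Fin k → ℕ → ℕ) → (Fin l → ℕ) → Prop} (hR : IsArithmetical l R)
      (hS : IsArithmetical l S) : IsArithmetical l (fun f v => R f v ∧ S f v)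
  | ex {l : ℕ} {R : (Fin k → ℕ → ℕ) → (Fin (l + 1) → ℕ) → Prop}
      (hR : IsArithmetical (l + 1) R) :
      IsArithmetical l (fun f v => ∃ n : ℕ, R f (Fin.snoc (α := fun _ => ℕ) v n))

/-- (Lightface) `Σ¹_2` relations between `k` reals: those of the form `∃ x ∀ y S(f, x, y)`,
where `x, y` range over the reals and `S` is arithmetical. -/
def IsSigmaOneTwo {k : ℕ} (R : (Fin k → ℕ → ℕ) → Prop) : Prop :=
  ∃ S : (Fin (k + 2) → ℕ → ℕ) → (Fin 0 → ℕ) → Prop, IsArithmetical 0 S ∧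
    ∀ f, R f ↔ ∃ x : ℕ → ℕ, ∀ y : ℕ → ℕ,
      S (Fin.snoc (α := fun _ => ℕ → ℕ) (Fin.snoc (α := fun _ => ℕ → ℕ) f x) y) ![]

end Codes

end NormIdeal

open NormIdeal

/-! The topological half is abstract. A closed base (`IsClosedBase`) is a family of non-empty closed
sets in which members that meet contain a common member, points have arbitrarily small members
through them, and disjoint subfamilies are countable. In a Polish space its members play the role of
open sets. Shrinking members prove a Baire category theorem (`notMem_meagerIdeal`). The meager sets
are those missing some ⋂ₙ ⋃ₖ B n k with each row predense (`mem_meagerIdeal_iff`), which gives Σ⁰₃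
hulls. Marczewski's argument for the Souslin operation gives the Baire property of analytic sets.

The combinatorial half shows that the sets POS(p) form a closed base. A condition is a stem plus
requirements "differ from `v i` somewhere on the finite block `D i`". Blocks coming from several
conditions overlap, but if each point lies in at most K of them, Hall's theorem thins them to
disjoint blocks at the cost of a constant factor, which a larger exponent m* absorbs; the finitely
many blocks of too low a level are settled by the stem (`exists_cond_pos_subset`). If two conditions
share a possibility η, low blocks are settled along η, and the growth of n̄ leaves the higher blocks
at least half of their points. Conditions with equal stem and exponent are always compatible, and
there are only countably many such pairs, whence the chain condition.

For index invariance, each block is cut into its parts inside and outside the range of π, and a part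
with at least half of the points is kept. The limit condition on n̄ gives a set POS(p) that is null
by Borel–Cantelli; it is also nowhere dense but not in the ideal, which separates the ideal from all
three others. For the Σ¹₂ bound, one real codes the predense families; compactness of X^ω makes
compatibility of codes arithmetical, and valuations of the code tree express membership in the coded
set, so that everything else fits under one universal real quantifier. -/

namespace NormIdeal

/-! ## Meager sets for families of closed sets -/

section ClosedBase

variable {X : Type u}

/-- A family of non-empty closed sets that behaves like a base satisfying the countable chain
condition. -/
structure IsClosedBase [TopologicalSpace X] (C : Set (Set X)) : Prop where
  isClosed : ∀ A ∈ C, IsClosed A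
  nonempty : ∀ A ∈ C, A.Nonempty
  inter : ∀ A ∈ C, ∀ B ∈ C, (A ∩ B).Nonempty → ∃ E ∈ C, E ⊆ A ∩ B
  exists_subset : ∀ x : X, ∀ U : Set X, IsOpen U → x ∈ U → ∃ A ∈ C, x ∈ A ∧ A ⊆ U
  ccc : ∀ D ⊆ C, D.PairwiseDisjoint id → D.Countable

/-! ### Closure properties of the meager ideal of an arbitrary family -/

theorem meagerIdeal_mono {C : Set (Set X)} {A B : Set X} (h : A ⊆ B) (hB : B ∈ meagerIdeal C) :
    A ∈ meagerIdeal C := by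
  obtain ⟨T, hT, hs⟩ := hB
  exact ⟨T, hT, h.trans hs⟩

theorem meagerIdeal_of_isSingularSet {C : Set (Set X)} {S : Set X} (h : IsSingularSet C S) :
    S ∈ meagerIdeal C :=
  ⟨fun _ => S, fun _ => h, subset_iUnion (fun _ : ℕ => S) 0⟩

theorem meagerIdeal_iUnion {C : Set (Set X)} {A : ℕ → Set X} (h : ∀ n, A n ∈ meagerIdeal C) :
    (⋃ n, A n) ∈ meagerIdeal C := by
  choose T hT hs using h
  refine ⟨fun n => T n.unpair.1 n.unpair.2, fun n => hT _ _, iUnion_subset fun n => ?_⟩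
  refine (hs n).trans (iUnion_subset fun k => ?_)
  have := subset_iUnion (fun m : ℕ => T m.unpair.1 m.unpair.2) (Nat.pair n k)
  simpa using this

theorem meagerIdeal_empty (C : Set (Set X)) : ∅ ∈ meagerIdeal C :=
  meagerIdeal_of_isSingularSet fun A hA => ⟨A, hA, by simp⟩

theorem meagerIdeal_biUnion {C : Set (Set X)} {ι : Type v} {s : Set ι} (hs : s.Countable)
    {A : ι → Set X} (h : ∀ i ∈ s, A i ∈ meagerIdeal C) : (⋃ i ∈ s, A i) ∈ meagerIdeal C := by
  rcases s.eq_empty_or_nonempty with rfl | hne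
  · simpa using meagerIdeal_empty C
  · obtain ⟨f, rfl⟩ := hs.exists_eq_range hne
    rw [biUnion_range]
    exact meagerIdeal_iUnion fun n => h _ (mem_range_self n)

theorem meagerIdeal_union {C : Set (Set X)} {A B : Set X} (hA : A ∈ meagerIdeal C)
    (hB : B ∈ meagerIdeal C) : A ∪ B ∈ meagerIdeal C := by
  rw [union_eq_iUnion]
  have := meagerIdeal_biUnion (C := C) (s := (univ : Set Bool)) (A := fun b => cond b A B)
    (to_countable _) (by rintro (_ | _) _ <;> assumption)
  simpa using this

namespace IsClosedBase

/-! ### Category and countable predense families in a closed base -/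

variable [TopologicalSpace X] {C : Set (Set X)}

/-- A point common to `A` and a member of `D` yields a common sub-member by `inter`; if there is no
such point, `A` itself avoids the union. -/
theorem isCategoryBase (hC : IsClosedBase C) : IsCategoryBase C where
  sUnion_eq := by
    refine eq_univ_of_forall fun x => ?_
    obtain ⟨A, hA, hx, -⟩ := hC.exists_subset x univ isOpen_univ trivial
    exact ⟨A, hA, hx⟩
  exists_of_subset := by
    rintro D hD - - - A hA ⟨B, hB, hBA⟩
    obtain ⟨x, hx⟩ := hC.nonempty B hB
    obtain ⟨E, hE, hxE⟩ := (hBA hx).2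
    exact ⟨E, hE, hC.inter A hA E (hD hE) ⟨x, (hBA hx).1, hxE⟩⟩
  exists_of_not_subset := by
    rintro D hD - - - A hA hn
    refine ⟨A, hA, fun x hx => ⟨hx, ?_⟩⟩
    rintro ⟨E, hE, hxE⟩
    obtain ⟨B, hB, hBA⟩ := hC.inter A hA E (hD hE) ⟨x, hx, hxE⟩
    exact hn ⟨B, hB, fun y hy => ⟨(hBA hy).1, E, hE, (hBA hy).2⟩⟩

/-- Baire's argument: descending members, the n-th step avoiding `T n` and with diameters tending to
0, have a common point by Cantor's intersection theorem. -/
theorem notMem_meagerIdeal [PolishSpace X] (hC : IsClosedBase C) {A : Set X} (hA : A ∈ C) :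
    A ∉ meagerIdeal C := by
  rintro ⟨T, hT, hs⟩
  let := TopologicalSpace.upgradeIsCompletelyMetrizable X
  -- Boundedness is carried along because `Metric.diam` of an unbounded set is 0 by convention.
  have step : ∀ (n : ℕ) (B : C), ∃ B' : C, (B' : Set X) ⊆ B.1 \ T n ∧
      Metric.diam (B' : Set X) ≤ 2 * (1 / 2) ^ n ∧ Bornology.IsBounded (B' : Set X) := by
    intro n B
    obtain ⟨B₁, hB₁, h₁⟩ := hT n B B.2
    obtain ⟨x, hx⟩ := hC.nonempty B₁ hB₁
    have hpos : (0 : ℝ) < (1 / 2) ^ n := by positivity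
    obtain ⟨B₂, hB₂, hx₂, h₂⟩ := hC.exists_subset x (Metric.ball x ((1 / 2) ^ n))
      Metric.isOpen_ball (Metric.mem_ball_self hpos)
    obtain ⟨B₃, hB₃, h₃⟩ := hC.inter B₁ hB₁ B₂ hB₂ ⟨x, hx, hx₂⟩
    have hsub : B₃ ⊆ Metric.ball x ((1 / 2) ^ n) := fun y hy => h₂ (h₃ hy).2
    refine ⟨⟨B₃, hB₃⟩, fun y hy => h₁ (h₃ hy).1, ?_, Metric.isBounded_ball.subset hsub⟩
    exact (Metric.diam_mono hsub Metric.isBounded_ball).trans (Metric.diam_ball hpos.le)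
  choose f hf hd hb using step
  let B : ℕ → C := fun n => Nat.rec ⟨A, hA⟩ (fun n B => f n B) n
  have hB : ∀ n, B (n + 1) = f n (B n) := fun n => rfl
  -- The sequence is used from index 1 on, since `A` itself need not be bounded.
  have hanti : Antitone fun n => (B (n + 1)).1 := antitone_nat_of_succ_le fun n => by
    change (B (n + 2)).1 ⊆ (B (n + 1)).1
    rw [hB (n + 1)]
    exact (hf (n + 1) (B (n + 1))).trans sdiff_subset
  have hne : (⋂ n, (B (n + 1)).1).Nonempty := by
    refine Metric.nonempty_iInter_of_nonempty_biInter (fun n => hC.isClosed _ (B (n + 1)).2)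
      (fun n => hb n (B n)) (fun N => ?_) ?_
    · obtain ⟨x, hx⟩ := hC.nonempty _ (B (N + 1)).2
      exact ⟨x, mem_iInter₂.2 fun n hn => hanti hn hx⟩
    · refine squeeze_zero (g := fun n => 2 * (1 / 2 : ℝ) ^ n) (fun n => Metric.diam_nonneg)
        (fun n => hd n (B n)) ?_
      have := tendsto_pow_atTop_nhds_zero_of_lt_one (r := (1 / 2 : ℝ)) (by norm_num) (by norm_num)
      simpa using this.const_mul 2
  obtain ⟨x, hx⟩ := hne
  rw [mem_iInter] at hx
  have hxA : x ∈ A := by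
    have := hx 0
    rw [hB] at this
    exact (hf 0 _ this).1
  obtain ⟨n, hn⟩ := mem_iUnion.1 (hs hxA)
  have := hx n
  rw [hB] at this
  exact (hf n _ this).2 hn

theorem isSigmaIdeal [PolishSpace X] [Nonempty X] (hC : IsClosedBase C) :
    IsSigmaIdeal (meagerIdeal C) where
  empty_mem := meagerIdeal_empty C
  mono _ _ h hB := meagerIdeal_mono h hB
  iUnion_mem _ h := meagerIdeal_iUnion h
  univ_notMem h := by
    obtain ⟨A, hA, -⟩ := hC.exists_subset (Classical.arbitrary X) univ isOpen_univ trivial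
    exact hC.notMem_meagerIdeal hA (meagerIdeal_mono (subset_univ A) h)

theorem isSingularSet_compl_sUnion (hC : IsClosedBase C) {E : Set (Set X)} (hE : E ⊆ C)
    (h : ∀ A ∈ C, ∃ B ∈ E, (A ∩ B).Nonempty) : IsSingularSet C (⋃₀ E)ᶜ := by
  intro A hA
  obtain ⟨B, hB, hne⟩ := h A hA
  obtain ⟨B', hB', hsub⟩ := hC.inter A hA B (hE hB) hne
  exact ⟨B', hB', fun x hx => ⟨(hsub hx).1, fun hn => hn ⟨B, hB, (hsub hx).2⟩⟩⟩

/-- A dense subfamily contains a countable maximal antichain. -/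
theorem exists_countable_predense (hC : IsClosedBase C) (P : Set X → Prop)
    (hP : ∀ A ∈ C, ∃ B ∈ C, B ⊆ A ∧ P B) :
    ∃ E ⊆ C, E.Countable ∧ (∀ B ∈ E, P B) ∧ ∀ A ∈ C, ∃ B ∈ E, (A ∩ B).Nonempty := by
  obtain ⟨E, hE⟩ := zorn_subset {E : Set (Set X) | E ⊆ {B ∈ C | P B} ∧ E.PairwiseDisjoint id} (by
    intro c hc hchain
    refine ⟨⋃₀ c, ⟨sUnion_subset fun s hs => (hc hs).1, ?_⟩, fun s hs => subset_sUnion_of_mem hs⟩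
    exact (pairwiseDisjoint_sUnion hchain.directedOn).2 fun s hs => (hc hs).2)
  obtain ⟨⟨hE₁, hE₂⟩, hmax⟩ := hE
  refine ⟨E, fun B hB => (hE₁ hB).1, hC.ccc E (fun B hB => (hE₁ hB).1) hE₂,
    fun B hB => (hE₁ hB).2, fun A hA => ?_⟩
  obtain ⟨B, hB, hBA, hPB⟩ := hP A hA
  by_contra hn
  push Not at hn
  -- If `A` missed every member of `E`, then `B` could be added to `E`, against maximality.
  have hdis : ∀ E' ∈ E, Disjoint B E' := fun E' hE' =>
    (disjoint_iff_inter_eq_empty.2 (hn E' hE')).mono_left hBA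
  have hmem : B ∈ E := by
    refine hmax (y := insert B E) ⟨insert_subset ⟨hB, hPB⟩ hE₁, ?_⟩ (subset_insert B E)
      (mem_insert B E)
    exact hE₂.insert fun E' hE' _ => hdis E' hE'
  obtain ⟨x, hx⟩ := hC.nonempty B hB
  exact disjoint_left.1 (hdis B hmem) hx hx

/-- The analogue of Banach's category theorem: local meagerness is global, because a maximal
antichain of witnesses is countable and its union has singular complement. -/
theorem mem_meagerIdeal_of_dense (hC : IsClosedBase C) {S : Set X}
    (h : ∀ A ∈ C, ∃ B ∈ C, B ⊆ A ∧ B ∩ S ∈ meagerIdeal C) : S ∈ meagerIdeal C := by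
  obtain ⟨E, hE, hc, hP, hd⟩ := hC.exists_countable_predense _ h
  refine meagerIdeal_mono ?_ (meagerIdeal_union
    (meagerIdeal_of_isSingularSet (hC.isSingularSet_compl_sUnion hE hd))
    (meagerIdeal_biUnion hc hP))
  intro x hx
  by_cases hxE : x ∈ ⋃₀ E
  · obtain ⟨B, hB, hxB⟩ := hxE
    exact Or.inr (mem_biUnion hB ⟨hxB, hx⟩)
  · exact Or.inl hxE

theorem compl_sUnion_mem_meagerIdeal (hC : IsClosedBase C) {E : Set (Set X)} (hE : E ⊆ C)
    (h : ∀ A ∈ C, ∃ B ∈ E, (A ∩ B).Nonempty) : (⋃₀ E)ᶜ ∈ meagerIdeal C :=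
  meagerIdeal_of_isSingularSet (hC.isSingularSet_compl_sUnion hE h)

/-- A description of the meager sets by countable predense families. -/
theorem mem_meagerIdeal_iff [Nonempty X] (hC : IsClosedBase C) {S : Set X} :
    S ∈ meagerIdeal C ↔ ∃ B : ℕ → ℕ → Set X, (∀ n k, B n k ∈ C) ∧
      (∀ A ∈ C, ∀ n, ∃ k, (A ∩ B n k).Nonempty) ∧ Disjoint S (⋂ n, ⋃ k, B n k) := by
  constructor
  · rintro ⟨T, hT, hs⟩
    have : ∀ n, ∃ B : ℕ → Set X, (∀ k, B k ∈ C ∧ Disjoint (B k) (T n)) ∧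
        ∀ A ∈ C, ∃ k, (A ∩ B k).Nonempty := by
      intro n
      obtain ⟨E, hE, hc, hP, hd⟩ := hC.exists_countable_predense (fun B => Disjoint B (T n))
        (fun A hA => by
          obtain ⟨B, hB, hBA⟩ := hT n A hA
          exact ⟨B, hB, hBA.trans sdiff_subset, disjoint_left.2 fun x hx => (hBA hx).2⟩)
      -- The base has a member, so the predense family is non-empty and can be listed by ω.
      obtain ⟨A₀, hA₀, -⟩ := hC.exists_subset (Classical.arbitrary X) univ isOpen_univ trivial
      obtain ⟨f, rfl⟩ := hc.exists_eq_range ((hd A₀ hA₀).imp fun _ h => h.1)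
      refine ⟨f, fun k => ⟨hE (mem_range_self k), hP _ (mem_range_self k)⟩, fun A hA => ?_⟩
      obtain ⟨_, ⟨k, rfl⟩, hk⟩ := hd A hA
      exact ⟨k, hk⟩
    choose B hB hd using this
    refine ⟨B, fun n k => (hB n k).1, fun A hA n => hd n A hA, disjoint_left.2 fun x hx hxB => ?_⟩
    obtain ⟨n, hn⟩ := mem_iUnion.1 (hs hx)
    obtain ⟨k, hk⟩ := mem_iUnion.1 (mem_iInter.1 hxB n)
    exact disjoint_left.1 (hB n k).2 hk hn
  · rintro ⟨B, hB, hd, hS⟩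
    refine ⟨fun n => (⋃₀ range (B n))ᶜ, fun n => hC.isSingularSet_compl_sUnion
      (range_subset_iff.2 (hB n)) fun A hA => ?_, fun x hx => ?_⟩
    · obtain ⟨k, hk⟩ := hd A hA n
      exact ⟨_, mem_range_self k, hk⟩
    · by_contra hn
      simp only [sUnion_range, mem_iUnion, mem_compl_iff, not_exists, not_not, not_forall] at hn
      exact disjoint_left.1 hS hx (mem_iInter.2 fun n => mem_iUnion.2 (hn n))

/-! ### Borel hulls -/

theorem iUnion_mem_sigmaZero_two {F : ℕ → Set X} (h : ∀ k, IsClosed (F k)) :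
    (⋃ k, F k) ∈ sigmaZero X 2 :=
  ⟨F, fun k => (h k).isOpen_compl, rfl⟩

theorem sUnion_mem_sigmaZero_two {E : Set (Set X)} (hE : E.Countable)
    (h : ∀ A ∈ E, IsClosed A) : ⋃₀ E ∈ sigmaZero X 2 := by
  rcases E.eq_empty_or_nonempty with rfl | hne
  · have := iUnion_mem_sigmaZero_two (X := X) (F := fun _ => ∅) fun _ => isClosed_empty
    simpa using this
  · obtain ⟨f, rfl⟩ := hE.exists_eq_range hne
    rw [sUnion_range]
    exact iUnion_mem_sigmaZero_two fun k => h _ (mem_range_self k)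

theorem measurableSet_of_mem_sigmaZero (n : ℕ) {A : Set X} (hA : A ∈ sigmaZero X (n + 1)) :
    MeasurableSet[borel X] A := by
  induction n generalizing A with
  | zero => exact MeasurableSpace.measurableSet_generateFrom hA
  | succ n ih =>
    obtain ⟨F, hF, rfl⟩ := hA
    exact @MeasurableSet.iUnion _ _ (borel X) _ _ fun k =>
      (@MeasurableSet.compl_iff _ _ (borel X)).1 (ih (hF k))

/-- The hull is the complement of ⋂ₙ ⋃ₖ B n k, an intersection of F_σ sets; the criterion
`mem_meagerIdeal_iff` applies to this complement with the same families. -/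
theorem exists_sigmaZero_three (hC : IsClosedBase C) [Nonempty X] {A : Set X}
    (hA : A ∈ meagerIdeal C) : ∃ B ∈ meagerIdeal C, B ∈ sigmaZero X 3 ∧ A ⊆ B := by
  obtain ⟨B, hB, hd, hS⟩ := hC.mem_meagerIdeal_iff.1 hA
  have hU : (⋂ n, ⋃ k, B n k)ᶜ = ⋃ n, (⋃ k, B n k)ᶜ := compl_iInter _
  refine ⟨(⋂ n, ⋃ k, B n k)ᶜ, hC.mem_meagerIdeal_iff.2 ⟨B, hB, hd, disjoint_compl_left⟩, ?_,
    hS.subset_compl_right⟩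
  exact ⟨fun n => (⋃ k, B n k)ᶜ, fun n => by
    rw [compl_compl]; exact iUnion_mem_sigmaZero_two fun k => hC.isClosed _ (hB n k), hU⟩

theorem hasBorelBasis (hC : IsClosedBase C) [Nonempty X] : HasBorelBasis (meagerIdeal C) := by
  intro A hA
  obtain ⟨B, hB, hB₃, hAB⟩ := hC.exists_sigmaZero_three hA
  exact ⟨B, hB, measurableSet_of_mem_sigmaZero 2 hB₃, hAB⟩

theorem diff_mem_piZero_three {G N : Set X} (hG : G ∈ sigmaZero X 2) (hN : N ∈ sigmaZero X 3) :
    G \ N ∈ piZero X 3 := by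
  obtain ⟨F, hF, rfl⟩ := hN
  -- The complement of `G \ N` is `Gᶜ ∪ N`: piece 0 is `Gᶜ`, the later ones are those of `N`.
  refine ⟨fun k => Nat.casesOn k Gᶜ F, fun k => ?_, ?_⟩
  · cases k with
    | zero => simpa using hG
    | succ k => exact hF k
  · ext x
    simp only [mem_compl_iff, Set.mem_sdiff, mem_iUnion, not_and, not_not]
    constructor
    · intro h
      by_cases hx : x ∈ G
      · obtain ⟨k, hk⟩ := h hx
        exact ⟨k + 1, hk⟩
      · exact ⟨0, hx⟩
    · rintro ⟨_ | k, hk⟩ hx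
      · exact absurd hx hk
      · exact ⟨k, hk⟩

/-- Every set with the Baire property is, up to a meager set, a union of countably many members
of the base. -/
theorem exists_sUnion_of_mem_baireSets (hC : IsClosedBase C) {A : Set X} (hA : A ∈ baireSets C) :
    ∃ E ⊆ C, E.Countable ∧ A \ ⋃₀ E ∈ meagerIdeal C ∧ ⋃₀ E \ A ∈ meagerIdeal C := by
  obtain ⟨E, hE, hc, hP, hd⟩ := hC.exists_countable_predense _ hA
  refine ⟨{B ∈ E | B \ A ∈ meagerIdeal C}, fun B hB => hE hB.1, hc.mono (sep_subset _ _), ?_, ?_⟩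
  · refine meagerIdeal_mono ?_ (meagerIdeal_union (hC.compl_sUnion_mem_meagerIdeal hE hd)
      (meagerIdeal_biUnion (s := {B ∈ E | B ∩ A ∈ meagerIdeal C}) (hc.mono (sep_subset _ _))
        fun B hB => hB.2))
    rintro x ⟨hxA, hx⟩
    by_cases hxE : x ∈ ⋃₀ E
    · obtain ⟨B, hB, hxB⟩ := hxE
      rcases hP B hB with h | h
      · exact Or.inr (mem_biUnion ⟨hB, h⟩ ⟨hxB, hxA⟩)
      · exact absurd ⟨B, ⟨hB, h⟩, hxB⟩ hx
    · exact Or.inl hxE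
  · refine meagerIdeal_mono ?_ (meagerIdeal_biUnion (s := {B ∈ E | B \ A ∈ meagerIdeal C})
      (hc.mono (sep_subset _ _)) fun B hB => hB.2)
    rintro x ⟨⟨B, hB, hxB⟩, hxA⟩
    exact mem_biUnion hB ⟨hxB, hxA⟩

theorem exists_piZero_three (hC : IsClosedBase C) [Nonempty X] {A : Set X}
    (hA : A ∈ baireSets C) : ∃ B ∈ piZero X 3, B ⊆ A ∧ A \ B ∈ meagerIdeal C := by
  obtain ⟨E, hE, hc, h₁, h₂⟩ := hC.exists_sUnion_of_mem_baireSets hA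
  obtain ⟨N, hN, hN₃, hsub⟩ := hC.exists_sigmaZero_three h₂
  refine ⟨⋃₀ E \ N, diff_mem_piZero_three
    (sUnion_mem_sigmaZero_two hc fun B hB => hC.isClosed B (hE hB)) hN₃, ?_, ?_⟩
  · rintro x ⟨hx, hxN⟩
    by_contra hxA
    exact hxN (hsub ⟨hx, hxA⟩)
  · refine meagerIdeal_mono ?_ (meagerIdeal_union h₁ hN)
    rintro x ⟨hxA, hx⟩
    by_cases hxE : x ∈ ⋃₀ E
    · exact Or.inr (by_contra fun hn => hx ⟨hxE, hn⟩)
    · exact Or.inl ⟨hxA, hxE⟩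

/-! ### Analytic sets -/

/-- Every set has a countable union of members of the base as a hull. -/
theorem exists_hull (hC : IsClosedBase C) (S : Set X) :
    ∃ E ⊆ C, (∀ B ∈ E, B ⊆ closure S) ∧ S \ ⋃₀ E ∈ meagerIdeal C ∧
      ∀ B ∈ E, ∀ B' ∈ C, B' ⊆ B → B' ∩ S ∉ meagerIdeal C := by
  obtain ⟨E, hE, hc, hP, hd⟩ := hC.exists_countable_predense
    (fun B => B ∩ S ∈ meagerIdeal C ∨ ∀ B' ∈ C, B' ⊆ B → B' ∩ S ∉ meagerIdeal C) (by
      intro A hA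
      by_cases h : ∃ B ∈ C, B ⊆ A ∧ B ∩ S ∈ meagerIdeal C
      · obtain ⟨B, hB, hBA, hBS⟩ := h
        exact ⟨B, hB, hBA, Or.inl hBS⟩
      · exact ⟨A, hA, subset_rfl, Or.inr fun B hB hBA hBS => h ⟨B, hB, hBA, hBS⟩⟩)
  refine ⟨{B ∈ E | ∀ B' ∈ C, B' ⊆ B → B' ∩ S ∉ meagerIdeal C}, fun B hB => hE hB.1, ?_, ?_,
    fun B hB => hB.2⟩
  -- A member of the hull reaching outside the closure of `S` would have a sub-member disjoint from
  -- `S`.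
  · rintro B ⟨hB, hBS⟩ x hx
    by_contra hn
    obtain ⟨A, hA, hxA, hsub⟩ := hC.exists_subset x _ isClosed_closure.isOpen_compl hn
    obtain ⟨B', hB', h'⟩ := hC.inter B (hE hB) A hA ⟨x, hx, hxA⟩
    refine hBS B' hB' (fun y hy => (h' hy).1) (meagerIdeal_mono ?_ (meagerIdeal_empty C))
    exact fun y hy => hsub (h' hy.1).2 (subset_closure hy.2)
  · refine meagerIdeal_mono ?_ (meagerIdeal_union (hC.compl_sUnion_mem_meagerIdeal hE hd)
      (meagerIdeal_biUnion (s := {B ∈ E | B ∩ S ∈ meagerIdeal C}) (hc.mono (sep_subset _ _))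
        fun B hB => hB.2))
    rintro x ⟨hxS, hx⟩
    by_cases hxE : x ∈ ⋃₀ E
    · obtain ⟨B, hB, hxB⟩ := hxE
      rcases hP B hB with h | h
      · exact Or.inr (mem_biUnion ⟨hB, h⟩ ⟨hxB, hxS⟩)
      · exact absurd ⟨B, ⟨hB, h⟩, hxB⟩ hx
    · exact Or.inl hxE

/-- Up to a meager set, the hull of a union is covered by the hulls of the pieces: a sub-member of
the hull missing all of these would meet `S` in a meager set, which hereditary non-meagerness
forbids. -/
theorem sUnion_diff_iUnion_mem_meagerIdeal (hC : IsClosedBase C) {S : Set X} {T : ℕ → Set X}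
    (hST : S = ⋃ n, T n) {E : Set (Set X)} {F : ℕ → Set (Set X)} (hE : E ⊆ C) (hF : ∀ n, F n ⊆ C)
    (hES : ∀ B ∈ E, ∀ B' ∈ C, B' ⊆ B → B' ∩ S ∉ meagerIdeal C)
    (hFT : ∀ n, T n \ ⋃₀ F n ∈ meagerIdeal C) : ⋃₀ E \ ⋃ n, ⋃₀ F n ∈ meagerIdeal C := by
  refine hC.mem_meagerIdeal_of_dense fun A hA => ?_
  by_cases hne : (A ∩ ⋃₀ E).Nonempty
  swap
  · refine ⟨A, hA, subset_rfl, meagerIdeal_mono ?_ (meagerIdeal_empty C)⟩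
    exact fun x hx => hne ⟨x, hx.1, hx.2.1⟩
  obtain ⟨x, hxA, B, hB, hxB⟩ := hne
  obtain ⟨B₂, hB₂, h₂⟩ := hC.inter A hA B (hE hB) ⟨x, hxA, hxB⟩
  have : ∃ n, (B₂ ∩ ⋃₀ F n).Nonempty := by
    by_contra hn
    push Not at hn
    refine hES B hB B₂ hB₂ (fun y hy => (h₂ hy).2) ?_
    refine meagerIdeal_mono ?_ (meagerIdeal_iUnion hFT)
    rw [hST]
    rintro y ⟨hy, hyT⟩
    obtain ⟨n, hyn⟩ := mem_iUnion.1 hyT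
    refine mem_iUnion.2 ⟨n, hyn, fun hyF => ?_⟩
    have : y ∈ B₂ ∩ ⋃₀ F n := ⟨hy, hyF⟩
    simp [hn n] at this
  obtain ⟨n, y, hy, B₃, hB₃, hyB₃⟩ := this
  obtain ⟨B₄, hB₄, h₄⟩ := hC.inter B₂ hB₂ B₃ (hF n hB₃) ⟨y, hy, hyB₃⟩
  refine ⟨B₄, hB₄, fun z hz => (h₂ (h₄ hz).1).1, meagerIdeal_mono ?_ (meagerIdeal_empty C)⟩
  rintro z ⟨hz, -, hn⟩
  exact hn (mem_iUnion.2 ⟨n, B₃, hB₃, (h₄ hz).2⟩)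

/-- Marczewski's argument. Take hulls of the images of all basic cylinders of Baire space. Outside a
meager set, a point of the hull of the whole image passes from the hull at each node to the hull at
some child; by continuity the branch so obtained is mapped to that point. -/
theorem analyticSet_mem_baireSets [T2Space X] (hC : IsClosedBase C) {A : Set X}
    (hA : AnalyticSet A) : A ∈ baireSets C := by
  rw [AnalyticSet] at hA
  obtain rfl | ⟨f, hf, rfl⟩ := hA
  · intro B hB
    exact ⟨B, hB, subset_rfl, Or.inl (by simpa using meagerIdeal_empty C)⟩
  -- `PiNat.res` lists an initial segment with its last entry first, so the children of `s` are the
  -- lists `n :: s`.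
  let T : List ℕ → Set X := fun s => f '' {y | PiNat.res y s.length = s}
  have hT : ∀ s, T s = ⋃ n, T (n :: s) := by
    intro s
    ext x
    simp only [T, mem_image, mem_ofPred_eq, mem_iUnion, List.length_cons, PiNat.res_succ,
      List.cons.injEq]
    constructor
    · rintro ⟨y, hy, rfl⟩
      exact ⟨y s.length, y, ⟨rfl, hy⟩, rfl⟩
    · rintro ⟨n, y, ⟨-, hy⟩, rfl⟩
      exact ⟨y, hy, rfl⟩
  have hT₀ : T [] = range f := by simp [T]
  choose E hE hcl hdiff hher using fun s => hC.exists_hull (T s)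
  have hZ : (⋃ s, (⋃₀ E s \ ⋃ n : ℕ, ⋃₀ E (n :: s))) ∈ meagerIdeal C := by
    have := meagerIdeal_biUnion (C := C) (s := (univ : Set (List ℕ))) (to_countable _)
      (A := fun s => ⋃₀ E s \ ⋃ n : ℕ, ⋃₀ E (n :: s))
      (fun s _ => hC.sUnion_diff_iUnion_mem_meagerIdeal (hT s) (hE s) (fun n => hE (n :: s))
        (hher s) (fun n => hdiff (n :: s)))
    simpa using this
  have hsub : ⋃₀ E [] \ range f ∈ meagerIdeal C := by
    refine meagerIdeal_mono ?_ hZ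
    rintro x ⟨hx, hxf⟩
    by_contra hn
    have hn' : ∀ s, x ∈ ⋃₀ E s → ∃ n : ℕ, x ∈ ⋃₀ E (n :: s) := fun s hs => by
      by_contra h
      exact hn (mem_iUnion.2 ⟨s, hs, fun h' => h (mem_iUnion.1 h')⟩)
    choose g hg using hn'
    let s : ℕ → {s : List ℕ // x ∈ ⋃₀ E s} := fun n =>
      Nat.rec ⟨[], hx⟩ (fun _ t => ⟨g t.1 t.2 :: t.1, hg t.1 t.2⟩) n
    let y : ℕ → ℕ := fun n => g (s n).1 (s n).2
    have hs : ∀ n, (s n).1 = PiNat.res y n := by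
      intro n
      induction n with
      | zero => rfl
      | succ n ih => rw [PiNat.res_succ, ← ih]
    refine hxf ⟨y, ?_⟩
    -- The point `x` lies in the closure of the image of every cylinder around `y`, while these
    -- images shrink to `f y`.
    by_contra hne
    obtain ⟨U, V, hU, hV, hyU, hxV, hUV⟩ := t2_separation hne
    have hyU' : f ⁻¹' U ∈ 𝓝 y := hf.continuousAt (hU.mem_nhds hyU)
    obtain ⟨_, ⟨z, n, rfl⟩, hyz, hzU⟩ := (PiNat.isTopologicalBasis_cylinders
      (fun _ : ℕ => ℕ)).mem_nhds_iff.1 hyU'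
    have hyc : PiNat.cylinder y n ⊆ f ⁻¹' U := by
      rwa [PiNat.mem_cylinder_iff_eq.1 hyz]
    obtain ⟨B, hB, hxB⟩ := (s n).2
    have hxc := hcl _ B hB hxB
    rw [hs] at hxc
    obtain ⟨w, hwV, hw⟩ := mem_closure_iff.1 hxc V hV hxV
    obtain ⟨t, ht, rfl⟩ := hw
    refine disjoint_left.1 hUV (hyc ?_) hwV
    rw [PiNat.cylinder_eq_res]
    simpa [PiNat.res_length] using ht
  intro B hB
  by_cases hne : (B ∩ ⋃₀ E []).Nonempty
  · obtain ⟨x, hxB, B₁, hB₁, hx₁⟩ := hne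
    obtain ⟨B₂, hB₂, h₂⟩ := hC.inter B hB B₁ (hE _ hB₁) ⟨x, hxB, hx₁⟩
    refine ⟨B₂, hB₂, fun y hy => (h₂ hy).1, Or.inr (meagerIdeal_mono ?_ hsub)⟩
    exact fun y hy => ⟨⟨B₁, hB₁, (h₂ hy.1).2⟩, hy.2⟩
  · refine ⟨B, hB, subset_rfl, Or.inl (meagerIdeal_mono ?_ (hdiff []))⟩
    rw [hT₀]
    exact fun y hy => ⟨hy.2, fun h => hne ⟨y, hy.1, h⟩⟩

/-- A non-meager Borel set contains a member of the base up to a meager set. Members chosen for two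
elements of an antichain are disjoint, since a common sub-member would be meager; so the chain
condition of the base transfers. -/
theorem isCCC [PolishSpace X] (hC : IsClosedBase C) : IsCCC (meagerIdeal C) := by
  intro F hF hpair
  have hex : ∀ A ∈ F, ∃ B ∈ C, B \ A ∈ meagerIdeal C := by
    intro A hA
    have hbaire : A ∈ baireSets C := by
      let : MeasurableSpace X := borel X
      have : BorelSpace X := ⟨rfl⟩
      exact hC.analyticSet_mem_baireSets (hF A hA).1.analyticSet
    by_contra hn
    refine (hF A hA).2 (hC.mem_meagerIdeal_of_dense fun B hB => ?_)
    obtain ⟨B', hB', hsub, h | h⟩ := hbaire B hB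
    · exact ⟨B', hB', hsub, h⟩
    · exact absurd ⟨B', hB', h⟩ hn
  choose! g hg hgA using hex
  have hdis : ∀ A ∈ F, ∀ A' ∈ F, A ≠ A' → Disjoint (g A) (g A') := by
    intro A hA A' hA' hne
    rw [disjoint_iff_inter_eq_empty, ← not_nonempty_iff_eq_empty]
    intro hint
    obtain ⟨B, hB, hsub⟩ := hC.inter _ (hg A hA) _ (hg A' hA') hint
    refine hC.notMem_meagerIdeal hB (meagerIdeal_mono ?_ (meagerIdeal_union (hpair hA hA' hne)
      (meagerIdeal_union (hgA A hA) (hgA A' hA'))))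
    intro x hx
    by_cases h₁ : x ∈ A
    · by_cases h₂ : x ∈ A'
      · exact Or.inl ⟨h₁, h₂⟩
      · exact Or.inr (Or.inr ⟨(hsub hx).2, h₂⟩)
    · exact Or.inr (Or.inl ⟨(hsub hx).1, h₁⟩)
  have hinj : F.InjOn g := by
    intro A hA A' hA' heq
    by_contra hne
    obtain ⟨x, hx⟩ := hC.nonempty _ (hg A hA)
    exact disjoint_left.1 (hdis A hA A' hA' hne) hx (heq ▸ hx)
  refine countable_of_injective_of_countable_image hinj (hC.ccc _ (image_subset_iff.2 hg) ?_)
  rintro _ ⟨A, hA, rfl⟩ _ ⟨A', hA', rfl⟩ hne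
  exact hdis A hA A' hA' fun h => hne (h ▸ rfl)

end IsClosedBase

end ClosedBase

/-! ## Conditions given by families of finite blocks -/

section Blocks

variable {H : ℕ → Type u} {n₀ n₁ : ℕ → ℕ} {ι : Type v}

/-- A total function extending a finite one. -/
noncomputable def FinFun.extend [∀ i, Nonempty (H i)] (s : FinFun H) : ∀ i, H i := fun i =>
  open Classical in if h : i ∈ s.dom then s.val ⟨i, h⟩ else Classical.arbitrary _

theorem FinFun.sub_iff [∀ i, Nonempty (H i)] (s : FinFun H) (η : ∀ i, H i) :
    s.Sub η ↔ ∀ x ∈ s.dom, η x = s.extend x := by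
  constructor
  · intro h x hx
    rw [h ⟨x, hx⟩, FinFun.extend, dif_pos hx]
  · rintro h ⟨x, hx⟩
    rw [h x hx, FinFun.extend, dif_pos hx]

/-- The functions that agree with `ω` on `W` and disagree with `v i` somewhere on `D i`, for
each `i`. -/
def condSet (W : Finset ℕ) (ω : ∀ i, H i) (D : ι → Finset ℕ) (v : ι → ∀ i, H i) :
    Set (∀ i, H i) :=
  {η | (∀ x ∈ W, η x = ω x) ∧ ∀ i, ∃ x ∈ D i, η x ≠ v i x}

/-- A family of finite sets with levels that obeys the bounds on the number and on the size of the
sets of each level. -/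
structure IsBlockFamily (n₀ n₁ : ℕ → ℕ) (M : ℕ) (ℓ : ι → ℕ) (D : ι → Finset ℕ) : Prop where
  encard_le : ∀ m, {i | ℓ i = m}.encard ≤ (n₁ m * 2 ^ M : ℕ)
  le_card : ∀ i, n₀ (ℓ i) ≤ 2 ^ M * (D i).card

theorem IsBlockFamily.finite {M : ℕ} {ℓ : ι → ℕ} {D : ι → Finset ℕ}
    (h : IsBlockFamily n₀ n₁ M ℓ D) (m : ℕ) : {i | ℓ i = m}.Finite :=
  Set.finite_of_encard_le_coe (h.encard_le m)

theorem IsBlockFamily.finite_lt {M : ℕ} {ℓ : ι → ℕ} {D : ι → Finset ℕ}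
    (h : IsBlockFamily n₀ n₁ M ℓ D) (m : ℕ) : {i | ℓ i < m}.Finite := by
  have : {i | ℓ i < m} = ⋃ k ∈ Finset.range m, {i | ℓ i = k} := by ext; simp
  rw [this]
  exact (Finset.range m).finite_toSet.biUnion fun k _ => h.finite k

theorem Cond.exists_blocks [∀ i, Nonempty (H i)] (p : Cond n₀ n₁ H) : ∃ (M : ℕ) (ℓ : ℕ → ℕ),
    IsBlockFamily n₀ n₁ M ℓ (fun j => (p.σ j).dom) ∧ ∀ j, M ≤ ℓ j := by
  obtain ⟨M, V, hV, hb⟩ := p.norm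
  choose ℓ hℓ huniq using fun j => hV j
  refine ⟨M, ℓ, ⟨fun m => ?_, fun j => ?_⟩, fun j => (hℓ j).1⟩
  · by_cases hm : M ≤ m
    · calc {i | ℓ i = m}.encard ≤ (V m : Set ℕ).encard :=
            Set.encard_le_encard fun j hj => by
              have := (hℓ j).2
              rwa [hj] at this
        _ = ((V m).card : ℕ) := Set.encard_coe_eq_coe_finsetCard _
        _ ≤ _ := by exact_mod_cast (hb m hm).1
    · have : {i | ℓ i = m} = ∅ := by
        ext j
        simp only [Set.mem_ofPred_eq, mem_empty_iff_false, iff_false]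
        rintro rfl
        exact hm (hℓ j).1
      simp [this]
  · have := (hb (ℓ j) (hℓ j).1).2 j (hℓ j).2
    rw [div_le_iff₀ (by positivity)] at this
    rw [mul_comm]
    exact_mod_cast this

theorem Cond.pos_eq [∀ i, Nonempty (H i)] (p : Cond n₀ n₁ H) :
    p.pos = condSet p.w.dom p.w.extend (fun j => (p.σ j).dom) (fun j => (p.σ j).extend) := by
  ext η
  simp only [Cond.pos, condSet, Set.mem_ofPred_eq, FinFun.sub_iff]
  push Not
  rfl

/-- Allows conditions to be built over any convenient index type. It must be infinite because the
forbidden functions are listed by all of ω; it is countable because every level is finite. -/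
theorem exists_cond_pos_eq [Infinite ι] {M : ℕ} {ℓ : ι → ℕ} {D : ι → Finset ℕ}
    (hD : IsBlockFamily n₀ n₁ M ℓ D) (hM : ∀ i, M ≤ ℓ i) {W : Finset ℕ}
    (hdis : ∀ i j, i ≠ j → Disjoint (D i) (D j)) (hW : ∀ i, Disjoint W (D i))
    (ω : ∀ i, H i) (v : ι → ∀ i, H i) :
    ∃ p : Cond n₀ n₁ H, p.pos = condSet W ω D v := by
  have hcount : Countable ι := by
    rw [← Set.countable_univ_iff]
    have : (univ : Set ι) = ⋃ m, {i | ℓ i = m} := by ext; simp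
    rw [this]
    exact countable_iUnion fun m => (hD.finite m).countable
  obtain ⟨_⟩ := nonempty_denumerable ι
  let e : ℕ ≃ ι := (Denumerable.eqv ι).symm
  have himg : ∀ m, e '' {j | ℓ (e j) = m} = {i | ℓ i = m} := fun m => by
    ext i
    constructor
    · rintro ⟨j, hj, rfl⟩
      exact hj
    · intro hi
      exact ⟨e.symm i, by simpa using hi, by simp⟩
  have hfin : ∀ m, {j | ℓ (e j) = m}.Finite := fun m =>
    Set.Finite.of_finite_image (f := e) (by rw [himg]; exact hD.finite m) e.injective.injOn
  refine ⟨⟨⟨W, fun i => ω i⟩, fun j => ⟨D (e j), fun i => v (e j) i⟩, fun j => hW _,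
    fun i j hij => hdis _ _ (e.injective.ne hij), M, fun m => (hfin m).toFinset, ?_, ?_⟩, ?_⟩
  · intro j
    refine ⟨ℓ (e j), ⟨hM _, by simp⟩, ?_⟩
    rintro m ⟨-, hm⟩
    simpa using (hm : j ∈ (hfin m).toFinset) |> fun h => ((hfin m).mem_toFinset.1 h).symm
  · intro m hm
    constructor
    · have := hD.encard_le m
      rw [← himg, e.injective.encard_image, (hfin m).encard_eq_coe_toFinset_card] at this
      exact_mod_cast this
    · intro j hj
      have hj' : ℓ (e j) = m := (hfin m).mem_toFinset.1 hj
      have := hD.le_card (e j)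
      rw [hj'] at this
      rw [div_le_iff₀ (by positivity), mul_comm]
      exact_mod_cast this
  · ext η
    simp only [Cond.pos, condSet, Set.mem_ofPred_eq, FinFun.Sub, Subtype.forall]
    push Not
    constructor
    · rintro ⟨h₁, h₂⟩
      exact ⟨h₁, fun i => by simpa using h₂ (e.symm i)⟩
    · rintro ⟨h₁, h₂⟩
      exact ⟨h₁, fun j => by simpa using h₂ (e j)⟩

/-- Families of finite sets in which no point is covered more than `K` times can be shrunk to
disjoint families at the cost of a factor `K`. -/
theorem exists_disjoint_subsets {K : ℕ} {D : ι → Finset ℕ} (κ : ι → Fin K)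
    (hκ : ∀ i j, i ≠ j → κ i = κ j → Disjoint (D i) (D j)) :
    ∃ E : ι → Finset ℕ, (∀ i, E i ⊆ D i) ∧ (∀ i j, i ≠ j → Disjoint (E i) (E j)) ∧
      ∀ i, (E i).card = (D i).card / K := by
  classical
  -- Hall's theorem with `(D i).card / K` copies of each `i`: every copy asks for a point of `D i`
  -- of its own.
  let t : (Σ i, Fin ((D i).card / K)) → Finset ℕ := fun a => D a.1
  have hall : ∀ s : Finset (Σ i, Fin ((D i).card / K)), s.card ≤ (s.biUnion t).card := by
    intro s
    rcases s.eq_empty_or_nonempty with rfl | ⟨a, -⟩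
    · simp
    have hK : 0 < K := (κ a.1).pos
    let I := s.image Sigma.fst
    have h₁ : s.card ≤ ∑ i ∈ I, (D i).card / K := by
      calc s.card ≤ (I.sigma fun i => (Finset.univ : Finset (Fin ((D i).card / K)))).card := by
            refine Finset.card_le_card fun b hb => ?_
            simp only [Finset.mem_sigma, Finset.mem_univ, and_true]
            exact Finset.mem_image_of_mem _ hb
        _ = _ := by simp
    -- Double counting of incidences: the sets through a given point have different colours, so
    -- there are at most `K` of them.
    have h₂ : ∑ i ∈ I, (D i).card ≤ (s.biUnion t).card * K := by
      have hU : ∀ i ∈ I, D i ⊆ s.biUnion t := by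
        intro i hi
        obtain ⟨b, hb, rfl⟩ := Finset.mem_image.1 hi
        exact Finset.subset_biUnion_of_mem t hb
      have := Finset.sum_card_bipartiteAbove_eq_sum_card_bipartiteBelow (s := I)
        (t := s.biUnion t) (fun i x => x ∈ D i)
      have h₃ : ∀ i ∈ I, (Finset.bipartiteAbove (fun i x => x ∈ D i) (s.biUnion t) i) = D i := by
        intro i hi
        ext x
        simp only [Finset.mem_bipartiteAbove]
        exact ⟨fun h => h.2, fun h => ⟨hU i hi h, h⟩⟩
      rw [Finset.sum_congr rfl fun i hi => congrArg Finset.card (h₃ i hi)] at this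
      rw [this]
      refine Finset.sum_le_card_nsmul _ _ _ fun x _ => ?_
      rw [← Fintype.card_fin K, ← Finset.card_univ]
      refine Finset.card_le_card_of_injOn κ (fun _ _ => Finset.mem_coe.2 (Finset.mem_univ _)) ?_
      intro i hi j hj hij
      by_contra hne
      exact Finset.disjoint_left.1 (hκ i j hne hij) ((Finset.mem_bipartiteBelow _).1 hi).2
        ((Finset.mem_bipartiteBelow _).1 hj).2
    refine Nat.le_of_mul_le_mul_right ?_ hK
    calc s.card * K ≤ (∑ i ∈ I, (D i).card / K) * K := Nat.mul_le_mul_right _ h₁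
      _ = ∑ i ∈ I, (D i).card / K * K := Finset.sum_mul ..
      _ ≤ ∑ i ∈ I, (D i).card := Finset.sum_le_sum fun i _ => Nat.div_mul_le_self _ _
      _ ≤ _ := h₂
  obtain ⟨f, hf, hft⟩ := (Finset.all_card_le_biUnion_card_iff_exists_injective t).1 hall
  refine ⟨fun i => Finset.univ.image fun k => f ⟨i, k⟩, fun i => ?_, fun i j hij => ?_, fun i => ?_⟩
  · intro x hx
    obtain ⟨k, -, rfl⟩ := Finset.mem_image.1 hx
    exact hft ⟨i, k⟩
  · rw [Finset.disjoint_left]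
    intro x hx hx'
    obtain ⟨k, -, rfl⟩ := Finset.mem_image.1 hx
    obtain ⟨k', -, h⟩ := Finset.mem_image.1 hx'
    exact hij (congrArg Sigma.fst (hf h)).symm
  · rw [Finset.card_image_of_injective _ fun k k' h => by simpa using hf h]
    simp

/-! ### Arithmetic of norm sequences and of block families -/

theorem IsNormSeq.lt_n₀ (hn : IsNormSeq n₀ n₁) (m : ℕ) : m < n₀ m := by
  have : StrictMono n₀ := strictMono_nat_of_lt_succ fun m => (hn.le m).trans_lt (hn.lt_succ m)
  induction m with
  | zero => exact (by norm_num : 0 < 4).trans (hn.four_lt 0)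
  | succ m ih => exact (Nat.succ_le_of_lt ih).trans_lt (this (Nat.lt_succ_self m))

theorem IsNormSeq.monotone (hn : IsNormSeq n₀ n₁) : Monotone n₀ :=
  monotone_nat_of_le_succ fun m => (hn.le m).trans (hn.lt_succ m).le

/-- Level 0 uses `4 < n₀ 0`; for m > 0 the sum condition gives `n₀ m > 2 ^ (2 * (m + 2)) ≥ 4 * 2 ^
m`. Five points are enough for thinning two superposed conditions, and for halving a block and
thinning once more. -/
theorem IsNormSeq.five_le {M m c : ℕ} (hn : IsNormSeq n₀ n₁) (hm : M ≤ m)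
    (h : n₀ m ≤ 2 ^ M * c) : 5 ≤ c := by
  by_contra hc
  have hc : c ≤ 4 := by omega
  have h₁ : n₀ m ≤ 2 ^ m * 4 := h.trans (Nat.mul_le_mul (Nat.pow_le_pow_right (by norm_num) hm) hc)
  rcases Nat.eq_zero_or_pos m with rfl | hpos
  · have := hn.four_lt 0
    omega
  · have h₂ := hn.sum_lt m
    have h₃ : 1 ≤ ∑ k ∈ Finset.range m, n₀ k * n₁ k := by
      calc 1 ≤ n₀ 0 * n₁ 0 := Nat.mul_pos (by have := hn.four_lt 0; omega)
            (by have := hn.four_lt 0; have := hn.le 0; omega)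
        _ ≤ _ := Finset.single_le_sum (f := fun k => n₀ k * n₁ k) (fun _ _ => Nat.zero_le _)
            (Finset.mem_range.2 hpos)
    have h₄ : 2 ^ m * 4 ≤ 2 ^ (2 * (m + 2)) := by
      calc 2 ^ m * 4 = 2 ^ (m + 2) := by ring
        _ ≤ _ := Nat.pow_le_pow_right (by norm_num) (by omega)
    have := Nat.mul_le_mul_left (2 ^ (2 * (m + 2))) h₃
    omega

/-- The number of blocks of level less than `L`. -/
theorem IsBlockFamily.card_lt_le {M : ℕ} {ℓ : ι → ℕ} {D : ι → Finset ℕ}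
    (h : IsBlockFamily n₀ n₁ M ℓ D) (L : ℕ) :
    (h.finite_lt L).toFinset.card ≤ ∑ m ∈ Finset.range L, n₁ m * 2 ^ M := by
  classical
  have : (h.finite_lt L).toFinset ⊆ (Finset.range L).biUnion fun m => (h.finite m).toFinset := by
    intro i hi
    simpa using hi
  refine (Finset.card_le_card this).trans (Finset.card_biUnion_le.trans ?_)
  refine Finset.sum_le_sum fun m _ => ?_
  have := h.encard_le m
  rw [(h.finite m).encard_eq_coe_toFinset_card] at this
  exact_mod_cast this

theorem encard_sum_eq {α β : Type*} (f : α → ℕ) (g : β → ℕ) (m : ℕ) :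
    {i : α ⊕ β | Sum.elim f g i = m}.encard = {i | f i = m}.encard + {i | g i = m}.encard := by
  have : {i : α ⊕ β | Sum.elim f g i = m} = Sum.inl '' {i | f i = m} ∪ Sum.inr '' {i | g i = m} := by
    ext (i | i) <;> simp
  rw [this, Set.encard_union_eq, Sum.inl_injective.encard_image, Sum.inr_injective.encard_image]
  rw [Set.disjoint_left]
  rintro _ ⟨i, -, rfl⟩ ⟨j, -, h⟩
  exact absurd h (by simp)

theorem IsBlockFamily.mono {M M' : ℕ} (hM : M ≤ M') {ℓ : ι → ℕ} {D D' : ι → Finset ℕ}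
    (h : IsBlockFamily n₀ n₁ M ℓ D) (hD : ∀ i, 2 ^ M * (D i).card ≤ 2 ^ M' * (D' i).card) :
    IsBlockFamily n₀ n₁ M' ℓ D' where
  encard_le m := (h.encard_le m).trans (by
    exact_mod_cast Nat.mul_le_mul_left _ (Nat.pow_le_pow_right (by norm_num) hM))
  le_card i := (h.le_card i).trans (hD i)

theorem IsBlockFamily.sum {ι' : Type*} {M M' L : ℕ} {ℓ : ι → ℕ} {D : ι → Finset ℕ} {ℓ' : ι' → ℕ}
    {D' : ι' → Finset ℕ} (h : IsBlockFamily n₀ n₁ M ℓ D) (h' : IsBlockFamily n₀ n₁ M' ℓ' D')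
    (hM : M + 1 ≤ L) (hM' : M' + 1 ≤ L) :
    IsBlockFamily n₀ n₁ L (Sum.elim ℓ ℓ') (Sum.elim D D') where
  encard_le m := by
    rw [encard_sum_eq]
    refine (add_le_add (h.encard_le m) (h'.encard_le m)).trans ?_
    have h₁ : 2 ^ (M + 1) ≤ 2 ^ L := Nat.pow_le_pow_right (by norm_num) hM
    have h₂ : 2 ^ (M' + 1) ≤ 2 ^ L := Nat.pow_le_pow_right (by norm_num) hM'
    rw [pow_succ] at h₁ h₂
    have : n₁ m * 2 ^ M + n₁ m * 2 ^ M' ≤ n₁ m * 2 ^ L := by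
      rw [← mul_add]
      exact Nat.mul_le_mul_left _ (by omega)
    exact_mod_cast this
  le_card := by
    rintro (i | i)
    · exact (h.le_card i).trans (Nat.mul_le_mul_right _
        (Nat.pow_le_pow_right (by norm_num) (by omega)))
    · exact (h'.le_card i).trans (Nat.mul_le_mul_right _
        (Nat.pow_le_pow_right (by norm_num) (by omega)))

theorem IsBlockFamily.comp {α : Type*} {M : ℕ} {ℓ : ι → ℕ} {D : ι → Finset ℕ}
    (h : IsBlockFamily n₀ n₁ M ℓ D) {f : α → ι} (hf : Function.Injective f) :
    IsBlockFamily n₀ n₁ M (ℓ ∘ f) (D ∘ f) where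
  encard_le m := by
    rw [← hf.encard_image]
    refine (Set.encard_le_encard ?_).trans (h.encard_le m)
    rintro _ ⟨i, hi, rfl⟩
    exact hi
  le_card i := h.le_card (f i)

/-- Infinitely many new blocks, one for each level, that avoid a given finite set. -/
theorem exists_fresh_blocks (hn : IsNormSeq n₀ n₁) (K : ℕ) (W : Finset ℕ) : ∃ E : ℕ → Finset ℕ,
    (∀ i j, i ≠ j → Disjoint (E i) (E j)) ∧ (∀ i, Disjoint W (E i)) ∧
      (∀ i, K * n₀ i ≤ (E i).card) ∧ IsBlockFamily n₀ n₁ 0 id E := by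
  -- Pairing keeps the blocks disjoint; the shift moves them beyond the maximum of `W`.
  let g : ℕ × ℕ → ℕ := fun a => Nat.pair a.1 a.2 + (W.sup id + 1)
  have hg : Function.Injective g := fun a b h => by
    have : Nat.pair a.1 a.2 = Nat.pair b.1 b.2 := Nat.add_right_cancel h
    rw [Nat.pair_eq_pair] at this
    exact Prod.ext this.1 this.2
  -- The factor `K + 1` in place of `K` guarantees `n₀ i` points even when `K = 0`.
  have hcard : ∀ i, ((Finset.range ((K + 1) * n₀ i)).image fun s => g (i, s)).card =
      (K + 1) * n₀ i := fun i => by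
    rw [Finset.card_image_of_injective _ fun s t h => by simpa using hg h, Finset.card_range]
  refine ⟨fun i => (Finset.range ((K + 1) * n₀ i)).image fun s => g (i, s), fun i j hij => ?_,
    fun i => ?_, fun i => ?_, fun m => ?_, fun i => ?_⟩
  · rw [Finset.disjoint_left]
    intro x hx hx'
    obtain ⟨k, -, rfl⟩ := Finset.mem_image.1 hx
    obtain ⟨k', -, h⟩ := Finset.mem_image.1 hx'
    exact hij (congrArg Prod.fst (hg h)).symm
  · rw [Finset.disjoint_left]
    intro x hx hx'
    obtain ⟨k, -, rfl⟩ := Finset.mem_image.1 hx'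
    have : g (i, k) ≤ W.sup id := Finset.le_sup (f := id) hx
    simp only [g] at this
    omega
  · rw [hcard]
    exact Nat.mul_le_mul_right _ (Nat.le_succ K)
  · have h₁ : {i : ℕ | id i = m} = {m} := by ext; simp
    rw [h₁, Set.encard_singleton, pow_zero, mul_one]
    have := hn.four_lt m
    have := hn.le m
    exact_mod_cast (by omega : 1 ≤ n₁ m)
  · rw [hcard, pow_zero, one_mul]
    exact Nat.le_mul_of_pos_left _ (Nat.succ_pos K)

theorem isClosed_condSet [∀ i, TopologicalSpace (H i)] [∀ i, DiscreteTopology (H i)]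
    (W : Finset ℕ) (ω : ∀ i, H i) (D : ι → Finset ℕ) (v : ι → ∀ i, H i) :
    IsClosed (condSet W ω D v) := by
  have : condSet W ω D v = (⋂ x ∈ W, (fun η : ∀ i, H i => η x) ⁻¹' {ω x}) ∩
      ⋂ i, ⋃ x ∈ D i, (fun η : ∀ i, H i => η x) ⁻¹' {v i x}ᶜ := by
    ext η
    simp [condSet]
  rw [this]
  refine IsClosed.inter ?_ ?_
  · exact isClosed_biInter fun x _ => (isClosed_discrete _).preimage (continuous_apply x)
  · exact isClosed_iInter fun i => (D i).finite_toSet.isClosed_biUnion fun x _ =>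
      (isClosed_discrete _).preimage (continuous_apply x)

/-! ### From overlapping requirements to conditions -/

variable [∀ i, Nontrivial (H i)]

/-- The main construction. Fresh blocks in one extra colour make the family infinite; Hall's theorem
thins all blocks to disjoint ones. Those of level at least the new exponent become forbidden
functions, and each of the others is met by one new point of the stem. The bound `K + 1` on the
sizes keeps the thinned blocks non-empty. -/
theorem exists_cond_pos_subset (hn : IsNormSeq n₀ n₁) {K M : ℕ} {ℓ : ι → ℕ} {D : ι → Finset ℕ}
    (hD : IsBlockFamily n₀ n₁ M ℓ D) (hK : ∀ i, K + 1 ≤ (D i).card) (κ : ι → Fin K)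
    (hκ : ∀ i j, i ≠ j → κ i = κ j → Disjoint (D i) (D j)) {W : Finset ℕ}
    (hW : ∀ i, Disjoint W (D i)) (ω : ∀ i, H i) (v : ι → ∀ i, H i) :
    ∃ p : Cond n₀ n₁ H, p.pos ⊆ condSet W ω D v := by
  classical
  obtain ⟨E, hEdis, hEW, hEcard, hE⟩ := exists_fresh_blocks hn (K + 1) W
  have hpos : ∀ m, 1 ≤ n₀ m := fun m => by have := hn.four_lt m; omega
  obtain ⟨F, hFsub, hFdis, hFcard⟩ := exists_disjoint_subsets (D := Sum.elim D E) (K := K + 1)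
    (Sum.elim (fun i => (κ i).castSucc) (fun _ => Fin.last K)) (by
      rintro (i | i) (j | j) hij h
      · exact hκ i j (fun h' => hij (h' ▸ rfl)) (Fin.castSucc_injective K h)
      · exact absurd h (Fin.castSucc_lt_last _).ne
      · exact absurd h.symm (Fin.castSucc_lt_last _).ne
      · exact hEdis i j fun h' => hij (h' ▸ rfl))
  have hlarge : ∀ i, K + 1 ≤ (Sum.elim D E i).card := by
    rintro (i | i)
    · exact hK i
    · exact (Nat.le_mul_of_pos_right _ (hpos i)).trans (hEcard i)
  have hFpos : ∀ i, 1 ≤ (F i).card := fun i => by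
    rw [hFcard]
    exact Nat.div_pos (hlarge i) (Nat.succ_pos K)
  have hFW : ∀ i, Disjoint W (F i) := fun i => by
    refine Finset.disjoint_of_subset_right (hFsub i) ?_
    rcases i with i | i
    · exact hW i
    · exact hEW i
  -- Integer division by `K + 1` loses at most a factor `2 * (K + 1)` because the quotient is
  -- positive.
  have hhalf : ∀ i, (Sum.elim D E i).card ≤ 2 ^ (K + 2) * (F i).card := by
    intro i
    have h₁ : (Sum.elim D E i).card < (K + 1) * ((F i).card + 1) := by
      rw [hFcard]
      exact Nat.lt_mul_div_succ _ (Nat.succ_pos K)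
    have h₂ : K + 1 ≤ 2 ^ (K + 1) := (Nat.lt_two_pow_self (n := K + 1)).le
    calc (Sum.elim D E i).card ≤ (K + 1) * ((F i).card + 1) := h₁.le
      _ ≤ 2 ^ (K + 1) * (2 * (F i).card) :=
          Nat.mul_le_mul h₂ (by have := hFpos i; omega)
      _ = _ := by ring
  -- `M + 1` pays for joining two families, `K + 2` for the thinning.
  let L := M + 1 + (K + 2)
  have hF : IsBlockFamily n₀ n₁ L (Sum.elim ℓ id) F := by
    refine (hD.sum hE le_rfl (by omega)).mono (M' := L) (by omega) fun i => ?_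
    calc 2 ^ (M + 1) * (Sum.elim D E i).card ≤ 2 ^ (M + 1) * (2 ^ (K + 2) * (F i).card) :=
          Nat.mul_le_mul_left _ (hhalf i)
      _ = _ := by simp only [L]; ring
  have hne : ∀ i, (F i).Nonempty := fun i => Finset.card_pos.1 (hFpos i)
  choose a ha using hne
  -- A condition with exponent `L` has no blocks below level `L`; the stem takes care of these
  -- finitely many.
  let low := (hF.finite_lt L).toFinset
  have hlow : ∀ i, i ∈ low ↔ Sum.elim ℓ id i < L := fun i => by simp [low]
  choose ne hne using fun x (y : H x) => exists_ne y
  let v' : ι ⊕ ℕ → ∀ i, H i := Sum.elim v fun _ => ω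
  let ω' : ∀ x, H x := fun x =>
    if h : ∃ i ∈ low, a i = x then ne x (v' h.choose x) else ω x
  have hω' : ∀ i ∈ low, ω' (a i) ≠ v' i (a i) := by
    intro i hi
    have h : ∃ j ∈ low, a j = a i := ⟨i, hi, rfl⟩
    have hij : h.choose = i := by
      by_contra hne'
      refine Finset.disjoint_left.1 (hFdis _ _ hne') (ha _) ?_
      rw [h.choose_spec.2]
      exact ha i
    simp only [ω', dif_pos h]
    have := hne (a i) (v' h.choose (a i))
    rwa [hij] at this ⊢
  have hωW : ∀ x ∈ W, ω' x = ω x := by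
    intro x hx
    refine dif_neg ?_
    rintro ⟨i, -, rfl⟩
    exact Finset.disjoint_left.1 (hFW i) hx (ha i)
  have hinf : Infinite {i : ι ⊕ ℕ // L ≤ Sum.elim ℓ id i} := by
    refine Infinite.of_injective (fun k : ℕ => ⟨Sum.inr (L + k), by simp⟩) fun k k' h => ?_
    exact Nat.add_left_cancel (Sum.inr_injective (congrArg Subtype.val h))
  obtain ⟨p, hp⟩ := exists_cond_pos_eq (ι := {i : ι ⊕ ℕ // L ≤ Sum.elim ℓ id i}) (n₀ := n₀)
    (n₁ := n₁) (M := L) (ℓ := fun i => Sum.elim ℓ id i.1) (D := fun i => F i.1)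
    (hF.comp Subtype.val_injective) (fun i => i.2) (W := W ∪ low.image a)
    (fun i j hij => hFdis _ _ fun h => hij (Subtype.ext h)) (fun i => by
      rw [Finset.disjoint_union_left]
      refine ⟨hFW _, Finset.disjoint_left.2 fun x hx hx' => ?_⟩
      obtain ⟨j, hj, rfl⟩ := Finset.mem_image.1 hx
      have hij : j ≠ i.1 := by
        rintro rfl
        exact absurd i.2 (not_le.2 ((hlow _).1 hj))
      exact Finset.disjoint_left.1 (hFdis _ _ hij) (ha j) hx') ω' (fun i => v' i.1)
  refine ⟨p, ?_⟩
  rw [hp]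
  rintro η ⟨h₁, h₂⟩
  refine ⟨fun x hx => ?_, fun i => ?_⟩
  · rw [h₁ x (Finset.mem_union_left _ hx), hωW x hx]
  · by_cases hi : L ≤ Sum.elim ℓ id (Sum.inl i : ι ⊕ ℕ)
    · obtain ⟨x, hx, hxv⟩ := h₂ ⟨Sum.inl i, hi⟩
      exact ⟨x, hFsub _ hx, hxv⟩
    · have hi' : (Sum.inl i : ι ⊕ ℕ) ∈ low := (hlow _).2 (not_le.1 hi)
      refine ⟨a (Sum.inl i), hFsub _ (ha _), ?_⟩
      rw [h₁ _ (Finset.mem_union_right _ (Finset.mem_image_of_mem a hi'))]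
      exact hω' _ hi'

/-- This is where the factor `2 ^ (2 * (M + 2))` in the definition of 𝒩 is needed: the sum bounds
the number of blocks below level `L`, so deleting one point for each of them takes at most a quarter
of a block of higher level. -/
theorem IsNormSeq.sum_mul_le (hn : IsNormSeq n₀ n₁) {M L m c : ℕ} (hM : M ≤ L) (hm : L ≤ m)
    (h : n₀ m ≤ 2 ^ M * c) : 4 * ∑ k ∈ Finset.range L, n₁ k * 2 ^ M ≤ c := by
  have h₁ : ∑ k ∈ Finset.range L, n₁ k * 2 ^ M ≤ 2 ^ M * ∑ k ∈ Finset.range L, n₀ k * n₁ k := by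
    rw [Finset.mul_sum]
    refine Finset.sum_le_sum fun k _ => ?_
    rw [mul_comm]
    refine Nat.mul_le_mul_left _ (Nat.le_mul_of_pos_left _ ?_)
    have := hn.four_lt k
    omega
  have h₂ := ((hn.sum_lt L).trans_le (hn.monotone hm)).le.trans h
  refine (Nat.mul_le_mul_left_iff (Nat.two_pow_pos M)).1 ?_
  calc 2 ^ M * (4 * ∑ k ∈ Finset.range L, n₁ k * 2 ^ M)
      ≤ 2 ^ M * (4 * (2 ^ M * ∑ k ∈ Finset.range L, n₀ k * n₁ k)) := by gcongr
    _ = 2 ^ (2 * (M + 1)) * ∑ k ∈ Finset.range L, n₀ k * n₁ k := by ring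
    _ ≤ 2 ^ (2 * (L + 2)) * ∑ k ∈ Finset.range L, n₀ k * n₁ k := by
      gcongr
      · norm_num
      · omega
    _ ≤ _ := h₂

/-- If all the requirements have a common solution `η`, then some condition meets them. -/
theorem exists_cond_pos_subset_of_solution (hn : IsNormSeq n₀ n₁) {K M : ℕ} {ℓ : ι → ℕ}
    {D : ι → Finset ℕ} (hD : IsBlockFamily n₀ n₁ M ℓ D) (κ : ι → Fin K)
    (hκ : ∀ i j, i ≠ j → κ i = κ j → Disjoint (D i) (D j)) (W : Finset ℕ) (v : ι → ∀ i, H i)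
    {η : ∀ i, H i} (hη : ∀ i, ∃ x ∈ D i, η x ≠ v i x) :
    ∃ p : Cond n₀ n₁ H, p.pos ⊆ condSet W η D v := by
  classical
  choose a ha hav using hη
  -- Chosen so that `L ≤ ℓ i < n₀ (ℓ i) ≤ 2 ^ M * (D i).card` yields `4 * (W.card + K + 1) ≤ (D
  -- i).card`; the summand `M` gives `M ≤ L`.
  let L := 2 ^ M * (4 * (W.card + K + 1)) + M
  let low := (hD.finite_lt L).toFinset
  have hlow : ∀ i, i ∈ low ↔ ℓ i < L := fun i => by simp [low]
  -- The coordinates frozen along `η`: the set `W` and one witness for each low block. They are at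
  -- most half of any high block.
  let F := W ∪ low.image a
  have hFcard : F.card ≤ W.card + ∑ m ∈ Finset.range L, n₁ m * 2 ^ M :=
    (Finset.card_union_le _ _).trans
      (Nat.add_le_add_left (Finset.card_image_le.trans (hD.card_lt_le L)) _)
  have hbig : ∀ i, L ≤ ℓ i → 4 * (W.card + K + 1) ≤ (D i).card ∧ 2 * F.card ≤ (D i).card := by
    intro i hi
    have h₁ := hD.le_card i
    have h₂ := hn.sum_mul_le (M := M) (by omega) hi h₁
    have h₃ : 4 * (W.card + K + 1) ≤ (D i).card := by
      refine (Nat.mul_le_mul_left_iff (Nat.two_pow_pos M)).1 ?_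
      have := hn.lt_n₀ (ℓ i)
      omega
    exact ⟨h₃, by omega⟩
  have hsd : ∀ i, (D i).card ≤ (D i \ F).card + F.card := fun i => by
    have := Finset.le_card_sdiff F (D i)
    omega
  -- High blocks lose at most half of their points to `F`, which costs one unit of the exponent.
  obtain ⟨p, hp⟩ := exists_cond_pos_subset (ι := {i // L ≤ ℓ i}) hn (K := K) (M := M + 1)
    (ℓ := fun i => ℓ i.1) (D := fun i => D i.1 \ F)
    ((hD.comp Subtype.val_injective).mono (Nat.le_succ M) fun i => by
      have := (hbig i.1 i.2).2
      have := hsd i.1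
      change 2 ^ M * (D i.1).card ≤ _
      rw [pow_succ, mul_assoc]
      exact Nat.mul_le_mul_left _ (by omega))
    (fun i => by
      have := hbig i.1 i.2
      have := hsd i.1
      omega) (fun i => κ i.1)
    (fun i j hij h => Finset.disjoint_of_subset_left Finset.sdiff_subset
      (Finset.disjoint_of_subset_right Finset.sdiff_subset
        (hκ _ _ (fun h' => hij (Subtype.ext h')) h))) (W := F)
    (fun i => Finset.disjoint_sdiff) η (fun i => v i.1)
  refine ⟨p, fun ζ hζ => ?_⟩
  obtain ⟨h₁, h₂⟩ := hp hζ
  refine ⟨fun x hx => h₁ x (Finset.mem_union_left _ hx), fun i => ?_⟩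
  by_cases hi : L ≤ ℓ i
  · obtain ⟨x, hx, hxv⟩ := h₂ ⟨i, hi⟩
    exact ⟨x, (Finset.mem_sdiff.1 hx).1, hxv⟩
  · refine ⟨a i, ha i, ?_⟩
    rw [h₁ _ (Finset.mem_union_right _ (Finset.mem_image_of_mem a ((hlow i).2 (not_le.1 hi))))]
    exact hav i

/-! ### Compatibility of conditions and the chain condition -/

theorem exists_color {α β : Type*} {D : α → Finset ℕ} {D' : β → Finset ℕ}
    (h : ∀ i j, i ≠ j → Disjoint (D i) (D j)) (h' : ∀ i j, i ≠ j → Disjoint (D' i) (D' j)) :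
    ∃ κ : α ⊕ β → Fin 2, ∀ i j, i ≠ j → κ i = κ j →
      Disjoint (Sum.elim D D' i) (Sum.elim D D' j) := by
  refine ⟨Sum.elim (fun _ => 0) (fun _ => 1), ?_⟩
  rintro (i | i) (j | j) hij hκ
  · exact h i j fun h => hij (h ▸ rfl)
  · simp at hκ
  · simp at hκ
  · exact h' i j fun h => hij (h ▸ rfl)

/-- A common possibility solves the requirements of both conditions at once and extends both stems;
two colours suffice for the superposed blocks. -/
theorem Cond.exists_pos_subset_inter (hn : IsNormSeq n₀ n₁) (p q : Cond n₀ n₁ H)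
    (h : (p.pos ∩ q.pos).Nonempty) : ∃ r : Cond n₀ n₁ H, r.pos ⊆ p.pos ∩ q.pos := by
  classical
  obtain ⟨M, ℓ, hp, -⟩ := p.exists_blocks
  obtain ⟨M', ℓ', hq, -⟩ := q.exists_blocks
  obtain ⟨κ, hκ⟩ := exists_color p.disjoint_σ q.disjoint_σ
  obtain ⟨η, hηp, hηq⟩ := h
  rw [p.pos_eq] at hηp ⊢
  rw [q.pos_eq] at hηq ⊢
  obtain ⟨r, hr⟩ := exists_cond_pos_subset_of_solution hn
    (hp.sum hq (L := max M M' + 1) (by omega) (by omega)) κ hκ (p.w.dom ∪ q.w.dom)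
    (Sum.elim (fun j => (p.σ j).extend) (fun j => (q.σ j).extend)) (η := η) (by
      rintro (j | j)
      · exact hηp.2 j
      · exact hηq.2 j)
  refine ⟨r, fun ζ hζ => ?_⟩
  obtain ⟨h₁, h₂⟩ := hr hζ
  exact ⟨⟨fun x hx => (h₁ x (Finset.mem_union_left _ hx)).trans (hηp.1 x hx),
      fun j => h₂ (Sum.inl j)⟩,
    ⟨fun x hx => (h₁ x (Finset.mem_union_right _ hx)).trans (hηq.1 x hx),
      fun j => h₂ (Sum.inr j)⟩⟩

/-- No common possibility is presupposed: with a common stem disjoint from all blocks, and blocks of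
at least five points in two colours, `exists_cond_pos_subset` applies directly. This is the source
of the chain condition. -/
theorem Cond.exists_pos_subset_inter_of_linked (hn : IsNormSeq n₀ n₁) {p q : Cond n₀ n₁ H}
    {M : ℕ} {ℓ ℓ' : ℕ → ℕ} (hp : IsBlockFamily n₀ n₁ M ℓ fun j => (p.σ j).dom)
    (hpM : ∀ j, M ≤ ℓ j) (hq : IsBlockFamily n₀ n₁ M ℓ' fun j => (q.σ j).dom)
    (hqM : ∀ j, M ≤ ℓ' j) (hw : p.w = q.w) : ∃ r : Cond n₀ n₁ H, r.pos ⊆ p.pos ∩ q.pos := by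
  obtain ⟨κ, hκ⟩ := exists_color p.disjoint_σ q.disjoint_σ
  obtain ⟨r, hr⟩ := exists_cond_pos_subset hn (hp.sum hq le_rfl le_rfl) (by
      rintro (j | j)
      · have := hn.five_le (hpM j) (hp.le_card j)
        simp only [Sum.elim_inl]; omega
      · have := hn.five_le (hqM j) (hq.le_card j)
        simp only [Sum.elim_inr]; omega) κ hκ (W := p.w.dom) (by
      rintro (j | j)
      · exact p.disjoint_w j
      · rw [hw]; exact q.disjoint_w j) p.w.extend
    (Sum.elim (fun j => (p.σ j).extend) (fun j => (q.σ j).extend))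
  refine ⟨r, fun ζ hζ => ?_⟩
  obtain ⟨h₁, h₂⟩ := hr hζ
  rw [p.pos_eq, q.pos_eq, ← hw]
  exact ⟨⟨h₁, fun j => h₂ (Sum.inl j)⟩, h₁, fun j => h₂ (Sum.inr j)⟩

theorem Cond.pos_nonempty (hn : IsNormSeq n₀ n₁) (p : Cond n₀ n₁ H) : p.pos.Nonempty := by
  classical
  obtain ⟨M, ℓ, hp, hM⟩ := p.exists_blocks
  have hne : ∀ j, (p.σ j).dom.Nonempty := fun j => Finset.card_pos.1 (by
    have := hn.five_le (hM j) (hp.le_card j)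
    omega)
  choose ne hne' using fun x (y : H x) => exists_ne y
  rw [p.pos_eq]
  refine ⟨fun x => if h : ∃ j, x ∈ (p.σ j).dom then ne x ((p.σ h.choose).extend x)
    else p.w.extend x, fun x hx => ?_, fun j => ?_⟩
  · refine dif_neg ?_
    rintro ⟨j, hj⟩
    exact Finset.disjoint_left.1 (p.disjoint_w j) hx hj
  · obtain ⟨x, hx⟩ := hne j
    have h : ∃ j, x ∈ (p.σ j).dom := ⟨j, hx⟩
    have hj : h.choose = j := by
      by_contra hne''
      exact Finset.disjoint_left.1 (p.disjoint_σ _ _ hne'') h.choose_spec hx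
    refine ⟨x, hx, ?_⟩
    simp only [dif_pos h]
    have := hne' x ((p.σ h.choose).extend x)
    rwa [hj] at this ⊢

theorem Cond.exists_mem_pos (hn : IsNormSeq n₀ n₁) (η : ∀ i, H i) (W : Finset ℕ) :
    ∃ p : Cond n₀ n₁ H, η ∈ p.pos ∧ ∀ ζ ∈ p.pos, ∀ x ∈ W, ζ x = η x := by
  obtain ⟨E, hdis, hW, hcard, hE⟩ := exists_fresh_blocks hn 1 W
  choose ne hne using fun x (y : H x) => exists_ne y
  -- The forbidden functions differ from `η` everywhere on fresh blocks, so `η` remains a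
  -- possibility.
  obtain ⟨p, hp⟩ := exists_cond_pos_eq hE (fun i => Nat.zero_le _) hdis hW η
    (fun _ x => ne x (η x))
  refine ⟨p, ?_, fun ζ hζ => ?_⟩
  · rw [hp]
    refine ⟨fun x _ => rfl, fun i => ?_⟩
    obtain ⟨x, hx⟩ := Finset.card_pos.1 (lt_of_lt_of_le (by have := hn.four_lt i; omega) (hcard i))
    exact ⟨x, hx, (hne x (η x)).symm⟩
  · rw [hp] at hζ
    exact hζ.1

theorem isClosedBase_posFamily [∀ i, Countable (H i)] [∀ i, TopologicalSpace (H i)]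
    [∀ i, DiscreteTopology (H i)] (hn : IsNormSeq n₀ n₁) :
    IsClosedBase (posFamily n₀ n₁ H) where
  isClosed := by
    rintro _ ⟨p, rfl⟩
    simp only [p.pos_eq]
    exact isClosed_condSet _ _ _ _
  nonempty := by
    rintro _ ⟨p, rfl⟩
    exact p.pos_nonempty hn
  inter := by
    rintro _ ⟨p, rfl⟩ _ ⟨q, rfl⟩ h
    obtain ⟨r, hr⟩ := p.exists_pos_subset_inter hn q h
    exact ⟨r.pos, ⟨r, rfl⟩, hr⟩
  exists_subset := by
    intro η U hU hη
    obtain ⟨I, u, hu, hsub⟩ := isOpen_pi_iff.1 hU η hη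
    obtain ⟨p, hp, hpW⟩ := Cond.exists_mem_pos (n₀ := n₀) (n₁ := n₁) hn η I
    refine ⟨p.pos, ⟨p, rfl⟩, hp, fun ζ hζ => hsub fun x hx => ?_⟩
    rw [hpW ζ hζ x hx]
    exact (hu x hx).2
  ccc := by
    intro F hF hdis
    have : Nonempty (Cond n₀ n₁ H) :=
      ⟨(Cond.exists_mem_pos hn (fun i => Classical.arbitrary (H i)) ∅).choose⟩
    have hex : ∀ A ∈ F, ∃ p : Cond n₀ n₁ H, p.pos = A := fun A hA => hF hA
    choose! p hp using hex
    choose M ℓ hb hM using fun p : Cond n₀ n₁ H => p.exists_blocks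
    -- Exponent and stem range over a countable set, the `H i` being countable; members with the
    -- same key are compatible, so disjoint members have different keys.
    let key : Set (∀ i, H i) → ℕ × Σ W : Finset ℕ, ∀ i : W, H i := fun A =>
      (M (p A), ⟨(p A).w.dom, (p A).w.val⟩)
    refine countable_of_injective_of_countable_image (f := key) ?_ (to_countable _)
    intro A hA B hB hAB
    have hM' : M (p A) = M (p B) := congrArg Prod.fst hAB
    have hw : (p A).w = (p B).w := by
      have h := congrArg Prod.snd hAB
      have h' := congrArg (fun s : Σ W : Finset ℕ, ∀ i : W, H i => FinFun.mk s.1 s.2) h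
      exact h'
    have hq := hb (p B)
    have hqM := hM (p B)
    rw [← hM'] at hq hqM
    obtain ⟨r, hr⟩ := Cond.exists_pos_subset_inter_of_linked hn (hb (p A)) (hM (p A)) hq hqM hw
    obtain ⟨η, hη⟩ := r.pos_nonempty hn
    by_contra hne
    have h₁ : η ∈ A := by rw [← hp A hA]; exact (hr hη).1
    have h₂ : η ∈ B := by rw [← hp B hB]; exact (hr hη).2
    exact disjoint_left.1 (hdis hA hB hne) h₁ h₂

end Blocks

/-! ## Invariance of the ideal on a power -/

section Invariance

theorem isSingularSet_image {X : Type u} {C : Set (Set X)} (T : Equiv.Perm X)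
    (h : ∀ A ∈ C, T '' A ∈ C) (h' : ∀ A ∈ C, T.symm '' A ∈ C) {S : Set X}
    (hS : IsSingularSet C S) : IsSingularSet C (T '' S) := by
  intro A hA
  obtain ⟨B, hB, hsub⟩ := hS _ (h' A hA)
  refine ⟨T '' B, h B hB, ?_⟩
  rintro _ ⟨x, hx, rfl⟩
  obtain ⟨⟨y, hy, rfl⟩, hxS⟩ := hsub hx
  refine ⟨by simpa using hy, ?_⟩
  rintro ⟨z, hz, hzx⟩
  exact hxS (T.injective hzx ▸ hz)

theorem meagerIdeal_image {X : Type u} {C : Set (Set X)} (T : Equiv.Perm X)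
    (h : ∀ A ∈ C, T '' A ∈ C) (h' : ∀ A ∈ C, T.symm '' A ∈ C) {A : Set X}
    (hA : A ∈ meagerIdeal C) : T '' A ∈ meagerIdeal C := by
  obtain ⟨S, hS, hsub⟩ := hA
  refine ⟨fun n => T '' S n, fun n => isSingularSet_image T h h' (hS n), ?_⟩
  rw [← image_iUnion]
  exact image_mono hsub

variable {n₀ n₁ : ℕ → ℕ}

theorem image_piCongrRight_mem_posFamily {H : ℕ → Type u} (T : ∀ i, Equiv.Perm (H i))
    {A : Set (∀ i, H i)} (hA : A ∈ posFamily n₀ n₁ H) :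
    Equiv.piCongrRight T '' A ∈ posFamily n₀ n₁ H := by
  obtain ⟨p, rfl⟩ := hA
  refine ⟨⟨⟨p.w.dom, fun i => T i (p.w.val i)⟩, fun j => ⟨(p.σ j).dom, fun i => T i ((p.σ j).val i)⟩,
    p.disjoint_w, p.disjoint_σ, p.norm⟩, ?_⟩
  ext η
  simp only [Cond.pos, FinFun.Sub, Set.mem_ofPred_eq]
  constructor
  · rintro ⟨h₁, h₂⟩
    refine ⟨(Equiv.piCongrRight T).symm η, ⟨fun i => ?_, fun j hj => h₂ j fun i => ?_⟩, by simp⟩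
    · simp [h₁ i]
    · rw [← hj i]
      simp
  · rintro ⟨ζ, ⟨h₁, h₂⟩, rfl⟩
    refine ⟨fun i => ?_, fun j hj => h₂ j fun i => (T i).injective (hj i)⟩
    simp [← h₁ i]

theorem image_piCongrRight_mem_meagerIdeal {H : ℕ → Type u} (T : ∀ i, Equiv.Perm (H i))
    {A : Set (∀ i, H i)} (hA : A ∈ meagerIdeal (posFamily n₀ n₁ H)) :
    Equiv.piCongrRight T '' A ∈ meagerIdeal (posFamily n₀ n₁ H) :=
  meagerIdeal_image _ (fun _ h => image_piCongrRight_mem_posFamily T h)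
    (fun _ h => image_piCongrRight_mem_posFamily (fun i => (T i).symm) h) hA

theorem isTranslationInvariant_meagerIdeal (X : Type v) [AddGroup X] :
    IsTranslationInvariant (meagerIdeal (posFamily n₀ n₁ (fun _ => X))) := fun x _ hA =>
  ⟨image_piCongrRight_mem_meagerIdeal (fun i => Equiv.addRight (x i)) hA,
    image_piCongrRight_mem_meagerIdeal (fun i => Equiv.addLeft (x i)) hA⟩

/-- Blocks of `p` with at least half of their points in the range of π are pulled back to a
condition `q`, which singularity refines to `q'`. The push-forward of `q'` is joined with the
outside parts of the other blocks. All blocks used are disjoint, hence the single colour `K = 1`. -/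
theorem isSingularSet_comp {X : Type v} [Nontrivial X] (hn : IsNormSeq n₀ n₁) {π : ℕ → ℕ}
    (hπ : Function.Injective π) {S : Set (ℕ → X)}
    (hS : IsSingularSet (posFamily n₀ n₁ (fun _ => X)) S) :
    IsSingularSet (posFamily n₀ n₁ (fun _ => X)) {x | x ∘ π ∈ S} := by
  classical
  rintro _ ⟨p, rfl⟩
  obtain ⟨M, ℓ, hp, hpM⟩ := p.exists_blocks
  let In : ℕ → Finset ℕ := fun j => (p.σ j).dom.preimage π hπ.injOn
  let Out : ℕ → Finset ℕ := fun j => (p.σ j).dom.filter fun x => x ∉ range π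
  have hcard : ∀ j, (In j).card + (Out j).card = (p.σ j).dom.card := fun j => by
    rw [Finset.card_preimage]
    exact Finset.card_filter_add_card_filter_not _
  have hfive : ∀ j, 5 ≤ (p.σ j).dom.card := fun j => hn.five_le (hpM j) (hp.le_card j)
  obtain ⟨q, hq⟩ := exists_cond_pos_subset (H := fun _ => X)
    (ι := {j // (p.σ j).dom.card ≤ 2 * (In j).card}) hn (K := 1) (M := M + 1)
    (ℓ := fun j => ℓ j.1) (D := fun j => In j.1)
    ((hp.comp Subtype.val_injective).mono (Nat.le_succ M) fun j => by
      rw [pow_succ, mul_assoc]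
      exact Nat.mul_le_mul_left _ j.2)
    (fun j => by have := hfive j.1; have := j.2; omega) (fun _ => 0)
    (fun i j hij _ => by
      rw [Finset.disjoint_left]
      intro x hx hx'
      exact Finset.disjoint_left.1 (p.disjoint_σ _ _ fun h => hij (Subtype.ext h))
        (Finset.mem_preimage.1 hx) (Finset.mem_preimage.1 hx'))
    (W := p.w.dom.preimage π hπ.injOn)
    (fun j => by
      rw [Finset.disjoint_left]
      intro x hx hx'
      exact Finset.disjoint_left.1 (p.disjoint_w _) (Finset.mem_preimage.1 hx)
        (Finset.mem_preimage.1 hx'))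
    (fun i => p.w.extend (π i)) (fun j i => (p.σ j.1).extend (π i))
  obtain ⟨_, ⟨q', rfl⟩, hq'⟩ := hS q.pos ⟨q, rfl⟩
  obtain ⟨M', ℓ', hb, hM'⟩ := q'.exists_blocks
  let D : {j // ¬ (p.σ j).dom.card ≤ 2 * (In j).card} ⊕ ℕ → Finset ℕ :=
    Sum.elim (fun j => Out j.1) (fun j => (q'.σ j).dom.map ⟨π, hπ⟩)
  obtain ⟨r, hr⟩ := exists_cond_pos_subset (H := fun _ => X) hn (K := 1) (D := D)
    (ℓ := Sum.elim (fun j => ℓ j.1) ℓ')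
    (IsBlockFamily.sum (M := M + 1) (M' := M') (L := max (M + 1) M' + 1)
      ((hp.comp Subtype.val_injective).mono (Nat.le_succ M) fun j => by
        have := hcard j.1
        have := j.2
        rw [pow_succ, mul_assoc]
        refine Nat.mul_le_mul_left _ ?_
        simp only [Function.comp]
        omega)
      (hb.mono le_rfl fun j => by rw [Finset.card_map]) (by omega) (by omega))
    (by
      rintro (j | j)
      · have := hcard j.1
        have := hfive j.1
        have := j.2
        simp only [D, Sum.elim_inl]
        omega
      · have := hn.five_le (hM' j) (hb.le_card j)
        simp only [D, Sum.elim_inr, Finset.card_map]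
        omega)
    (fun _ => 0)
    (by
      have hio : ∀ (i : ℕ) (j : ℕ), Disjoint (Out i) ((q'.σ j).dom.map ⟨π, hπ⟩) := by
        intro i j
        rw [Finset.disjoint_left]
        intro x hx hx'
        obtain ⟨y, -, rfl⟩ := Finset.mem_map.1 hx'
        exact (Finset.mem_filter.1 hx).2 ⟨y, rfl⟩
      rintro (i | i) (j | j) hij -
      · exact Finset.disjoint_of_subset_left (Finset.filter_subset _ _)
          (Finset.disjoint_of_subset_right (Finset.filter_subset _ _)
            (p.disjoint_σ _ _ fun h => hij (congrArg Sum.inl (Subtype.ext h))))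
      · exact hio _ _
      · exact (hio _ _).symm
      · exact (Finset.disjoint_map _).2 (q'.disjoint_σ _ _ fun h => hij (h ▸ rfl)))
    (W := (p.w.dom.filter fun x => x ∉ range π) ∪ q'.w.dom.map ⟨π, hπ⟩)
    (by
      rintro (j | j) <;> simp only [D, Sum.elim_inl, Sum.elim_inr] <;>
        rw [Finset.disjoint_union_left]
      · refine ⟨Finset.disjoint_of_subset_left (Finset.filter_subset _ _)
          (Finset.disjoint_of_subset_right (Finset.filter_subset _ _) (p.disjoint_w _)), ?_⟩
        rw [Finset.disjoint_left]
        intro x hx hx'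
        obtain ⟨y, -, rfl⟩ := Finset.mem_map.1 hx
        exact (Finset.mem_filter.1 hx').2 ⟨y, rfl⟩
      · refine ⟨?_, (Finset.disjoint_map _).2 (q'.disjoint_w _)⟩
        rw [Finset.disjoint_left]
        intro x hx hx'
        obtain ⟨y, -, rfl⟩ := Finset.mem_map.1 hx'
        exact (Finset.mem_filter.1 hx).2 ⟨y, rfl⟩)
    -- On the range of π the stem follows `q'`, elsewhere it follows `p`.
    (Function.extend π q'.w.extend p.w.extend)
    (Sum.elim (fun j => (p.σ j.1).extend)
      (fun j => Function.extend π (q'.σ j).extend fun _ => Classical.arbitrary X))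
  refine ⟨r.pos, ⟨r, rfl⟩, fun ζ hζ => ?_⟩
  obtain ⟨h₁, h₂⟩ := hr hζ
  -- Hence `ζ ∘ π` is a possibility of `q` too, which settles those requirements of `p` that were
  -- pulled back.
  have hζq' : ζ ∘ π ∈ q'.pos := by
    rw [q'.pos_eq]
    refine ⟨fun x hx => ?_, fun j => ?_⟩
    · have := h₁ (π x) (Finset.mem_union_right _ (Finset.mem_map_of_mem ⟨π, hπ⟩ hx))
      rwa [hπ.extend_apply] at this
    · obtain ⟨x, hx, hxv⟩ := h₂ (Sum.inr j)
      obtain ⟨y, hy, rfl⟩ := Finset.mem_map.1 hx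
      refine ⟨y, hy, ?_⟩
      simpa [hπ.extend_apply] using hxv
  obtain ⟨hζq, hζS⟩ := hq' hζq'
  obtain ⟨h₃, h₄⟩ := hq hζq
  refine ⟨?_, hζS⟩
  change ζ ∈ p.pos
  rw [p.pos_eq]
  refine ⟨fun x hx => ?_, fun j => ?_⟩
  · by_cases hxr : x ∈ range π
    · obtain ⟨y, rfl⟩ := hxr
      exact h₃ y (Finset.mem_preimage.2 hx)
    · rw [h₁ x (Finset.mem_union_left _ (Finset.mem_filter.2 ⟨hx, hxr⟩)),
        Function.extend_apply' _ _ _ hxr]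
  · by_cases hj : (p.σ j).dom.card ≤ 2 * (In j).card
    · obtain ⟨x, hx, hxv⟩ := h₄ ⟨j, hj⟩
      exact ⟨π x, Finset.mem_preimage.1 hx, hxv⟩
    · obtain ⟨x, hx, hxv⟩ := h₂ (Sum.inl ⟨j, hj⟩)
      exact ⟨x, (Finset.mem_filter.1 hx).1, hxv⟩

theorem isIndexInvariant_meagerIdeal (X : Type v) [Nontrivial X] (hn : IsNormSeq n₀ n₁) :
    IsIndexInvariant (meagerIdeal (posFamily n₀ n₁ (fun _ => X))) := by
  rintro π hπ A ⟨T, hT, hs⟩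
  refine ⟨fun n => {x | x ∘ π ∈ T n}, fun n => isSingularSet_comp hn hπ (hT n), fun x hx => ?_⟩
  obtain ⟨n, hn⟩ := mem_iUnion.1 (hs hx)
  exact mem_iUnion.2 ⟨n, hn⟩

end Invariance

/-! ## Comparison with the ideals of first category sets and of null sets -/

section Comparison

variable {n₀ n₁ : ℕ → ℕ}

/-- The set is closed, and a basic open set restricts only finitely many coordinates. As the domains
are disjoint, some forbidden function avoids these coordinates and can be realised inside the open
set. -/
theorem Cond.isMeagre_pos {H : ℕ → Type u} [∀ i, Nontrivial (H i)] [∀ i, TopologicalSpace (H i)]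
    [∀ i, DiscreteTopology (H i)] (p : Cond n₀ n₁ H) : IsMeagre p.pos := by
  classical
  have hcl : IsClosed p.pos := by
    rw [p.pos_eq]
    exact isClosed_condSet _ _ _ _
  refine IsNowhereDense.isMeagre ((IsClosed.isNowhereDense_iff hcl).2 ?_)
  by_contra hne
  obtain ⟨η, hη⟩ := nonempty_iff_ne_empty.2 hne
  obtain ⟨I, u, hu, hsub⟩ := isOpen_pi_iff.1 isOpen_interior η hη
  obtain ⟨j, hj⟩ : ∃ j, Disjoint I (p.σ j).dom := by
    by_contra hI
    push Not at hI
    simp only [Finset.not_disjoint_iff] at hI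
    choose f hfI hf using hI
    refine not_injective_infinite_finite (fun j => (⟨f j, hfI j⟩ : I)) fun i j hij => ?_
    by_contra hne'
    have : f i = f j := congrArg Subtype.val hij
    exact Finset.disjoint_left.1 (p.disjoint_σ i j hne') (hf i) (this ▸ hf j)
  let ζ : ∀ i, H i := fun x => if x ∈ (p.σ j).dom then (p.σ j).extend x else η x
  have hζ : ζ ∈ p.pos := by
    refine interior_subset (hsub fun x hx => ?_)
    have : ζ x = η x := if_neg fun h => Finset.disjoint_left.1 hj hx h
    rw [this]
    exact (hu x hx).2
  exact hζ.2 j (((p.σ j).sub_iff ζ).2 fun x hx => if_pos hx)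

/-- The use of the limit condition on n̄: with `c` the cardinality of `X`, the `n₁ m` blocks of size
`n₀ m` have probabilities adding up to at least 1. -/
theorem IsNormSeq.eventually_pow_le (hn : IsNormSeq n₀ n₁) (c : ℕ) :
    ∀ᶠ m in atTop, c ^ n₀ m ≤ n₁ m := by
  filter_upwards [hn.tendsto.eventually_ge_atTop (max c 1 : ℝ)] with m hm
  have h₀ : 0 < n₀ m := by have := hn.four_lt m; omega
  have h₁ : (0 : ℝ) < 2 * (n₀ m : ℝ) := by positivity
  have h₂ : ((max c 1 : ℝ)) ^ (2 * n₀ m) ≤ n₁ m := by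
    calc ((max c 1 : ℝ)) ^ (2 * n₀ m) ≤ ((n₁ m : ℝ) ^ (1 / (2 * (n₀ m : ℝ)))) ^ (2 * n₀ m) := by
          gcongr
      _ = n₁ m := by
          rw [← Real.rpow_natCast, ← Real.rpow_mul (Nat.cast_nonneg _)]
          push_cast
          rw [one_div_mul_cancel h₁.ne', Real.rpow_one]
  have h₃ : (c : ℝ) ^ n₀ m ≤ n₁ m := by
    calc (c : ℝ) ^ n₀ m ≤ (max c 1 : ℝ) ^ n₀ m := by gcongr; exact le_max_left _ _
      _ ≤ (max c 1 : ℝ) ^ (2 * n₀ m) := pow_le_pow_right₀ (le_max_right _ _) (by omega)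
      _ ≤ _ := h₂
  exact_mod_cast h₃

/-- The second Borel–Cantelli lemma for a product of uniform measures: if the family of finite
sets `D i` is disjoint and infinitely often small, then almost every function takes the constant
value `c` on one of them. -/
theorem condSet_mem_nullIdeal {X : Type v} [Fintype X] [Nonempty X] {ι : Type} [Infinite ι]
    [Countable ι] {D : ι → Finset ℕ} (hdis : ∀ i j, i ≠ j → Disjoint (D i) (D j)) (c : X)
    (ω : ℕ → X) (h : ∑' i, ((Fintype.card X : ENNReal)⁻¹) ^ (D i).card = ⊤) :
    condSet (H := fun _ => X) ∅ ω D (fun _ _ => c) ∈ nullIdeal X := by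
  classical
  let : MeasurableSpace X := ⊤
  let μ : Measure (ℕ → X) := Measure.infinitePi fun _ : ℕ => (PMF.uniformOfFintype X).toMeasure
  change μ _ = 0
  obtain ⟨_⟩ := nonempty_denumerable ι
  let e : ℕ ≃ ι := (Denumerable.eqv ι).symm
  let A : ι → Set (ℕ → X) := fun i => Set.pi (D i) fun _ => {c}
  have hμ : ∀ s : Finset ℕ, μ (Set.pi s fun _ => {c}) = ((Fintype.card X : ENNReal)⁻¹) ^ s.card := by
    intro s
    rw [Measure.infinitePi_pi _ fun _ _ => MeasurableSpace.measurableSet_top]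
    simp [PMF.toMeasure_apply_singleton _ _ (MeasurableSpace.measurableSet_top)]
  have hmeas : ∀ i, MeasurableSet (A i) := fun i =>
    MeasurableSet.pi (D i).countable_toSet fun _ _ => MeasurableSpace.measurableSet_top
  have hindep : ProbabilityTheory.iIndepSet (fun n => A (e n)) μ := by
    rw [ProbabilityTheory.iIndepSet_iff_meas_biInter fun n => hmeas _]
    intro s
    have hU : ⋂ n ∈ s, A (e n) = Set.pi (s.biUnion fun n => D (e n)) fun _ => {c} := by
      ext η
      simp only [A, mem_iInter, Set.mem_pi, Finset.mem_coe, Finset.mem_biUnion]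
      exact ⟨fun h x ⟨n, hn, hx⟩ => h n hn x hx, fun h n hn x hx => h x ⟨n, hn, hx⟩⟩
    rw [hU, hμ, Finset.card_biUnion fun i _ j _ hij => hdis _ _ (e.injective.ne hij),
      ← Finset.prod_pow_eq_pow_sum]
    exact Finset.prod_congr rfl fun n _ => (hμ _).symm
  have hsum : ∑' n, μ (A (e n)) = ⊤ := by
    rw [e.tsum_eq fun i => μ (A i), ← h]
    exact tsum_congr fun i => hμ _
  have hlim := ProbabilityTheory.measure_limsup_eq_one (fun n => hmeas (e n)) hindep hsum
  have hsub : condSet (H := fun _ => X) ∅ ω D (fun _ _ => c) ⊆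
      (limsup (fun n => A (e n)) atTop)ᶜ := by
    rintro η ⟨-, hη⟩ hmem
    rw [limsup_eq_iInf_iSup_of_nat] at hmem
    simp only [iSup_eq_iUnion, iInf_eq_iInter, mem_iInter, mem_iUnion] at hmem
    obtain ⟨n, -, hn⟩ := hmem 0
    obtain ⟨x, hx, hxc⟩ := hη (e n)
    exact hxc (hn x hx)
  refine measure_mono_null hsub ?_
  rw [prob_compl_eq_zero_iff]
  · exact hlim
  · exact MeasurableSet.measurableSet_limsup fun n => hmeas (e n)

/-- The witness uses the full allowance, `n₁ m` disjoint blocks of size `n₀ m` on each level, and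
forbids a constant value on each block. -/
theorem Cond.exists_pos_mem_nullIdeal (X : Type v) [Fintype X] [Nontrivial X]
    (hn : IsNormSeq n₀ n₁) : ∃ p : Cond n₀ n₁ (fun _ => X), p.pos ∈ nullIdeal X := by
  classical
  let g : ℕ × ℕ × ℕ → ℕ := Encodable.encode
  have hg : Function.Injective g := Encodable.encode_injective
  let D : (Σ m, Fin (n₁ m)) → Finset ℕ := fun i =>
    (Finset.range (n₀ i.1)).image fun s => g (i.1, i.2, s)
  have hcard : ∀ i, (D i).card = n₀ i.1 := fun i => by
    rw [Finset.card_image_of_injective _ fun s t h => by simpa using hg h, Finset.card_range]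
  have hdis : ∀ i j, i ≠ j → Disjoint (D i) (D j) := by
    rintro ⟨m, t⟩ ⟨m', t'⟩ hij
    rw [Finset.disjoint_left]
    intro x hx hx'
    obtain ⟨k, -, rfl⟩ := Finset.mem_image.1 hx
    obtain ⟨k', -, h⟩ := Finset.mem_image.1 hx'
    have := hg h
    simp only [Prod.mk.injEq] at this
    obtain ⟨rfl, h', -⟩ := this
    exact hij (congrArg _ (Fin.ext h'.symm))
  have hpos : ∀ m, 0 < n₁ m := fun m => by have := hn.four_lt m; have := hn.le m; omega
  have : Infinite (Σ m, Fin (n₁ m)) :=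
    Infinite.of_injective (fun m => (⟨m, ⟨0, hpos m⟩⟩ : Σ m, Fin (n₁ m))) fun m m' h =>
      congrArg Sigma.fst h
  have hD : IsBlockFamily n₀ n₁ 0 Sigma.fst D := by
    refine ⟨fun m => ?_, fun i => by rw [hcard]; simp⟩
    have : {i : Σ m, Fin (n₁ m) | i.1 = m} = range (Sigma.mk m) := by
      ext ⟨m', t⟩
      constructor
      · rintro rfl
        exact ⟨t, rfl⟩
      · rintro ⟨t', h⟩
        exact (congrArg Sigma.fst h).symm
    rw [this, ← image_univ, sigma_mk_injective.encard_image, Set.encard_univ]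
    simp
  obtain ⟨c⟩ : Nonempty X := inferInstance
  obtain ⟨p, hp⟩ := exists_cond_pos_eq (H := fun _ => X) hD (fun _ => Nat.zero_le _) (W := ∅) hdis
    (fun _ => Finset.disjoint_empty_left _) (fun _ => c) (fun _ _ => c)
  refine ⟨p, ?_⟩
  rw [hp]
  refine condSet_mem_nullIdeal hdis c _ ?_
  by_contra hne
  rw [ENNReal.tsum_sigma'] at hne
  -- If the probabilities had a finite sum, the level sums would tend to 0, but they are eventually
  -- at least 1.
  have htend := ENNReal.tendsto_atTop_zero_of_tsum_ne_top hne
  have hlt := htend.eventually (gt_mem_nhds zero_lt_one)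
  obtain ⟨m, hm₁, hm₂⟩ := (hlt.and (hn.eventually_pow_le (Fintype.card X))).exists
  refine absurd hm₁ (not_lt.2 ?_)
  simp only [hcard, tsum_fintype, Finset.sum_const, Finset.card_univ, Fintype.card_fin, nsmul_eq_mul]
  rw [← ENNReal.inv_pow, ← div_eq_mul_inv, ENNReal.le_div_iff_mul_le, one_mul]
  · exact_mod_cast hm₂
  · left
    simp
  · left
    exact ENNReal.pow_ne_top (ENNReal.natCast_ne_top _)

theorem meagerIdeal_ne (X : Type v) [Fintype X] [Nontrivial X] [TopologicalSpace X]
    [DiscreteTopology X] (hn : IsNormSeq n₀ n₁) :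
    meagerIdeal (posFamily n₀ n₁ (fun _ => X)) ≠ firstCategoryIdeal (ℕ → X) ∧
    meagerIdeal (posFamily n₀ n₁ (fun _ => X)) ≠ nullIdeal X ∧
    meagerIdeal (posFamily n₀ n₁ (fun _ => X)) ≠ firstCategoryIdeal (ℕ → X) ∩ nullIdeal X := by
  have : PolishSpace X := inferInstance
  obtain ⟨p, hp⟩ := Cond.exists_pos_mem_nullIdeal X hn
  have h₁ : p.pos ∈ firstCategoryIdeal (ℕ → X) := p.isMeagre_pos
  have h₂ : p.pos ∉ meagerIdeal (posFamily n₀ n₁ (fun _ => X)) :=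
    (isClosedBase_posFamily hn).notMem_meagerIdeal ⟨p, rfl⟩
  exact ⟨fun h => h₂ (h ▸ h₁), fun h => h₂ (h ▸ hp), fun h => h₂ (h ▸ ⟨h₁, hp⟩)⟩

end Comparison

/-! ## Arithmetical relations with parameters in primcodable types -/

section Arithmetical

variable {k : ℕ}

theorem primrec_pi_fin {α σ : Type*} [Primcodable α] [Primcodable σ] {n : ℕ} {f : α → Fin n → σ}
    (h : ∀ i, Primrec fun a => f a i) : Primrec f :=
  Primrec.fin_curry.2 (Primrec.fin_curry₁ (f := fun i a => f a i) |>.2 h).swap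

theorem primrec_fin_apply {n : ℕ} (i : Fin n) : Primrec fun v : Fin n → ℕ => v i :=
  Primrec.fin_app.comp Primrec.id (Primrec.const i)

/-- Only `app` needs an idea: its arguments must be variables, so the substituted terms are named by
two existential number quantifiers. -/
theorem IsArithmetical.subst {l : ℕ} {R : (Fin k → ℕ → ℕ) → (Fin l → ℕ) → Prop}
    (hR : IsArithmetical l R) {m : ℕ} {g : (Fin m → ℕ) → Fin l → ℕ} (hg : Primrec g) :
    IsArithmetical m fun f v => R f (g v) := by
  induction hR generalizing m with
  | primrec P hP => exact .primrec _ (hP.comp hg)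
  | @app l i a b =>
    have hr : Primrec fun (w : Fin (m + 2) → ℕ) (j : Fin m) => w j.castSucc.castSucc :=
      primrec_pi_fin fun j => primrec_fin_apply _
    have h₁ : PrimrecPred fun w : Fin (m + 2) → ℕ =>
        w (Fin.last m).castSucc = g (fun j => w j.castSucc.castSucc) a ∧
          w (Fin.last (m + 1)) = g (fun j => w j.castSucc.castSucc) b :=
      (Primrec.eq.comp (primrec_fin_apply _)
        ((primrec_fin_apply a).comp (hg.comp hr))).and
      (Primrec.eq.comp (primrec_fin_apply _)
        ((primrec_fin_apply b).comp (hg.comp hr)))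
    have h₂ := ((IsArithmetical.primrec (k := k) _ h₁).and
      (IsArithmetical.app i (Fin.last m).castSucc (Fin.last (m + 1)))).ex.ex
    convert! h₂ using 3 with f v
    simp only [Fin.snoc_castSucc, Fin.snoc_last]
    constructor
    · exact fun h => ⟨_, _, ⟨rfl, rfl⟩, h⟩
    · rintro ⟨_, _, ⟨rfl, rfl⟩, h⟩
      exact h
  | not _ ih => exact .not (ih hg)
  | and _ _ ih₁ ih₂ => exact .and (ih₁ hg) (ih₂ hg)
  | @ex l R _ ih =>
    have hg' : Primrec fun (w : Fin (m + 1) → ℕ) =>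
        (Fin.snoc (α := fun _ => ℕ) (g fun j => w j.castSucc) (w (Fin.last m)) :
          Fin (l + 1) → ℕ) := by
      refine primrec_pi_fin fun i => ?_
      refine Fin.lastCases ?_ (fun i => ?_) i
      · simpa using primrec_fin_apply (Fin.last m)
      · simp only [Fin.snoc_castSucc]
        exact (primrec_fin_apply i).comp (hg.comp (primrec_pi_fin fun j => primrec_fin_apply _))
    convert! (ih hg').ex using 5 with f v n
    simp

/-- A relation between reals and an element of a primcodable type is arithmetical if the
corresponding relation for the codes of the elements is. -/
def IsArith {α : Type} [Primcodable α] (R : (Fin k → ℕ → ℕ) → α → Prop) : Prop :=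
  IsArithmetical 1 fun f v => ∃ a, Encodable.decode (v 0) = some a ∧ R f a

variable {α β γ δ : Type} [Primcodable α] [Primcodable β] [Primcodable γ] [Primcodable δ]

theorem isArithmetical_isSome (α : Type) [Primcodable α] {l : ℕ} {g : (Fin l → ℕ) → ℕ}
    (hg : Primrec g) :
    IsArithmetical (k := k) l fun _ v => ∃ a : α, Encodable.decode (g v) = some a := by
  refine .primrec _ (PrimrecPred.of_eq (p := fun v =>
    (Encodable.decode (g v) : Option α).isSome = true) ?_ fun v => Option.isSome_iff_exists)
  exact Primrec.eq.comp (Primrec.option_isSome.comp (Primrec.decode.comp hg)) (Primrec.const true)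

namespace IsArith

variable {R S : (Fin k → ℕ → ℕ) → α → Prop}

theorem comp {R : (Fin k → ℕ → ℕ) → β → Prop} (hR : IsArith R) {g : α → β} (hg : Primrec g) :
    IsArith fun f a => R f (g a) := by
  have h₀ : Primrec fun v : Fin 1 → ℕ => v 0 := primrec_fin_apply 0
  -- `some b` is encoded by the successor of the code of `b`, so subtracting 1 gives that code;
  -- failed decodings are excluded by a separate conjunct.
  have hg' : Primrec fun v : Fin 1 → ℕ =>
      (![Encodable.encode ((Encodable.decode (v 0) : Option α).map g) - 1] : Fin 1 → ℕ) := by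
    refine primrec_pi_fin fun i => ?_
    have : Primrec fun v : Fin 1 → ℕ => (Encodable.decode (v 0) : Option α).map g :=
      (Primrec.option_map₁ hg).comp (Primrec.decode.comp h₀)
    simpa using! Primrec.pred.comp (Primrec.encode.comp this)
  have h := (isArithmetical_isSome (k := k) α h₀).and (hR.subst hg')
  rw [IsArith]
  convert! h using 3 with f v
  constructor
  · rintro ⟨a, ha, h⟩
    exact ⟨⟨a, ha⟩, g a, by simp [ha], h⟩
  · rintro ⟨⟨a, ha⟩, b, hb, h⟩
    refine ⟨a, ha, ?_⟩
    simp only [ha, Option.map_some, Encodable.encode_some, Matrix.cons_val_fin_one,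
      Nat.succ_sub_one, Encodable.encodek, Option.some.injEq] at hb
    exact hb ▸ h

protected theorem not (hR : IsArith R) : IsArith fun f a => ¬ R f a := by
  have h := (isArithmetical_isSome (k := k) α (primrec_fin_apply (0 : Fin 1))).and (.not hR)
  rw [IsArith]
  convert! h using 3 with f v
  constructor
  · rintro ⟨a, ha, h⟩
    refine ⟨⟨a, ha⟩, ?_⟩
    rintro ⟨b, hb, h'⟩
    rw [ha, Option.some.injEq] at hb
    exact h (hb ▸ h')
  · rintro ⟨⟨a, ha⟩, h⟩
    exact ⟨a, ha, fun h' => h ⟨a, ha, h'⟩⟩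

protected theorem and (hR : IsArith R) (hS : IsArith S) : IsArith fun f a => R f a ∧ S f a := by
  have h := IsArithmetical.and hR hS
  rw [IsArith]
  convert! h using 3 with f v
  constructor
  · rintro ⟨a, ha, h₁, h₂⟩
    exact ⟨⟨a, ha, h₁⟩, a, ha, h₂⟩
  · rintro ⟨⟨a, ha, h₁⟩, b, hb, h₂⟩
    rw [ha, Option.some.injEq] at hb
    exact ⟨a, ha, h₁, hb ▸ h₂⟩

theorem congr (hR : IsArith R) (h : ∀ f a, S f a ↔ R f a) : IsArith S := by
  have : S = R := funext fun f => funext fun a => propext (h f a)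
  rwa [this]

protected theorem or (hR : IsArith R) (hS : IsArith S) : IsArith fun f a => R f a ∨ S f a :=
  (hR.not.and hS.not).not.congr fun _ _ => by tauto

protected theorem imp (hR : IsArith R) (hS : IsArith S) : IsArith fun f a => R f a → S f a :=
  (hR.and hS.not).not.congr fun _ _ => by tauto

protected theorem iff (hR : IsArith R) (hS : IsArith S) : IsArith fun f a => (R f a ↔ S f a) :=
  ((hR.imp hS).and (hS.imp hR)).congr fun _ _ => iff_iff_implies_and_implies

protected theorem ex {R : (Fin k → ℕ → ℕ) → α → β → Prop}
    (hR : IsArith fun f (p : α × β) => R f p.1 p.2) : IsArith fun f a => ∃ b, R f a b := by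
  have hg : Primrec fun v : Fin 2 → ℕ => (![Nat.pair (v 0) (v 1)] : Fin 1 → ℕ) := by
    refine primrec_pi_fin fun i => ?_
    simpa using! Primrec₂.natPair.comp (primrec_fin_apply (0 : Fin 2)) (primrec_fin_apply 1)
  have h := (hR.subst hg).ex
  rw [IsArith]
  convert! h using 3 with f v
  have h₀ : ∀ n, (Fin.snoc (α := fun _ => ℕ) v n : Fin 2 → ℕ) 0 = v 0 := fun n =>
    Fin.snoc_castSucc (α := fun _ => ℕ) n v 0
  have h₁ : ∀ n, (Fin.snoc (α := fun _ => ℕ) v n : Fin 2 → ℕ) 1 = n := fun n =>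
    Fin.snoc_last (α := fun _ => ℕ) n v
  simp only [h₀, h₁, Matrix.cons_val_fin_one, Encodable.decode_prod_val, Nat.unpair_pair]
  constructor
  · rintro ⟨a, ha, b, h⟩
    exact ⟨Encodable.encode b, (a, b), by simp [ha], h⟩
  · rintro ⟨n, ⟨a, b⟩, hab, h⟩
    simp only [Option.bind_eq_some_iff, Option.map_eq_some_iff, Prod.mk.injEq] at hab
    obtain ⟨a', ha, b', -, rfl, rfl⟩ := hab
    exact ⟨a', ha, b', h⟩

protected theorem all {R : (Fin k → ℕ → ℕ) → α → β → Prop}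
    (hR : IsArith fun f (p : α × β) => R f p.1 p.2) : IsArith fun f a => ∀ b, R f a b :=
  (IsArith.ex (R := fun f a b => ¬ R f a b) hR.not).not.congr fun _ _ => by push Not; rfl

theorem of_primrecPred {P : α → Prop} (hP : PrimrecPred P) :
    IsArith (k := k) fun _ a => P a := by
  classical
  refine .primrec _ (PrimrecPred.of_eq (p := fun v : Fin 1 → ℕ =>
    (Encodable.decode (v 0) : Option α).map (fun a => decide (P a)) = some true) ?_ fun v => ?_)
  · exact Primrec.eq.comp ((Primrec.option_map₁ hP.decide).comp
      (Primrec.decode.comp (primrec_fin_apply 0))) (Primrec.const _)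
  · simp

end IsArith

/-- Functions with arithmetical graph. -/
def IsArithFun (t : (Fin k → ℕ → ℕ) → α → β) : Prop :=
  IsArith fun f (p : α × β) => t f p.1 = p.2

/-- The value of `t` is named by an existential quantifier over `β`, so terms that mention reals can
be substituted. -/
theorem IsArith.comp_fun {R : (Fin k → ℕ → ℕ) → β → Prop} (hR : IsArith R)
    {t : (Fin k → ℕ → ℕ) → α → β} (ht : IsArithFun t) : IsArith fun f a => R f (t f a) :=
  (IsArith.ex (R := fun f a b => t f a = b ∧ R f b)
    (IsArith.and ht (hR.comp Primrec.snd))).congr fun _ _ => by simp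

namespace IsArithFun

theorem of_primrec {g : α → β} (hg : Primrec g) : IsArithFun (k := k) fun _ a => g a :=
  IsArith.of_primrecPred (Primrec.eq.comp (hg.comp Primrec.fst) Primrec.snd)

protected theorem pair {s : (Fin k → ℕ → ℕ) → α → β} {t : (Fin k → ℕ → ℕ) → α → γ}
    (hs : IsArithFun s) (ht : IsArithFun t) : IsArithFun fun f a => (s f a, t f a) :=
  ((IsArith.comp hs (Primrec.fst.pair (Primrec.fst.comp Primrec.snd))).and
    (IsArith.comp ht (Primrec.fst.pair (Primrec.snd.comp Primrec.snd)))).congr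
      fun _ _ => Prod.ext_iff

theorem comp {s : (Fin k → ℕ → ℕ) → β → γ} (hs : IsArithFun s)
    {t : (Fin k → ℕ → ℕ) → α → β} (ht : IsArithFun t) : IsArithFun fun f a => s f (t f a) :=
  (IsArith.ex (R := fun f (p : α × γ) b => t f p.1 = b ∧ s f b = p.2)
    ((IsArith.comp ht ((Primrec.fst.comp Primrec.fst).pair Primrec.snd)).and
      (IsArith.comp hs (Primrec.snd.pair (Primrec.snd.comp Primrec.fst))))).congr
        fun _ _ => by simp

theorem comp₂ {h : β → γ → δ} (hh : Primrec₂ h) {s : (Fin k → ℕ → ℕ) → α → β}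
    {t : (Fin k → ℕ → ℕ) → α → γ} (hs : IsArithFun s) (ht : IsArithFun t) :
    IsArithFun fun f a => h (s f a) (t f a) :=
  (of_primrec (k := k) hh).comp (hs.pair ht)

theorem const (b : β) : IsArithFun (k := k) fun _ (_ : α) => b := of_primrec (Primrec.const b)

protected theorem id : IsArithFun (k := k) fun _ (a : α) => a := of_primrec Primrec.id

theorem fst {t : (Fin k → ℕ → ℕ) → α → β × γ} (ht : IsArithFun t) :
    IsArithFun fun f a => (t f a).1 :=
  (of_primrec Primrec.fst).comp ht

theorem snd {t : (Fin k → ℕ → ℕ) → α → β × γ} (ht : IsArithFun t) :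
    IsArithFun fun f a => (t f a).2 :=
  (of_primrec Primrec.snd).comp ht

variable {s t : (Fin k → ℕ → ℕ) → α → ℕ}

theorem apply_real (i : Fin k) (ht : IsArithFun t) : IsArithFun fun f a => f i (t f a) := by
  have h : IsArithFun (k := k) fun f (n : ℕ) => f i n := by
    have h := (isArithmetical_isSome (k := k) (ℕ × ℕ) (primrec_fin_apply (0 : Fin 1))).and
      ((IsArithmetical.app i (0 : Fin 2) 1).subst (m := 1)
        (g := fun v => ![(v 0).unpair.1, (v 0).unpair.2]) (primrec_pi_fin fun j => by
          have h₀ : Primrec fun v : Fin 1 → ℕ => (v 0).unpair :=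
            Primrec.unpair.comp (primrec_fin_apply 0)
          refine Fin.cases ?_ (fun j => ?_) j
          · exact Primrec.fst.comp h₀
          · simpa using! Primrec.snd.comp h₀))
    rw [IsArithFun, IsArith]
    convert! h using 3 with f v
    simp
  exact h.comp ht

theorem natPair (hs : IsArithFun s) (ht : IsArithFun t) :
    IsArithFun fun f a => Nat.pair (s f a) (t f a) := comp₂ Primrec₂.natPair hs ht

theorem natUnpair (ht : IsArithFun t) : IsArithFun fun f a => Nat.unpair (t f a) :=
  (of_primrec Primrec.unpair).comp ht

theorem add (hs : IsArithFun s) (ht : IsArithFun t) :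
    IsArithFun fun f a => s f a + t f a := comp₂ Primrec.nat_add hs ht

theorem mul (hs : IsArithFun s) (ht : IsArithFun t) :
    IsArithFun fun f a => s f a * t f a := comp₂ Primrec.nat_mul hs ht

theorem two_pow (ht : IsArithFun t) : IsArithFun fun f a => 2 ^ t f a := by
  refine (of_primrec (α := ℕ) (g := fun n => 2 ^ n) ?_).comp ht
  refine (Primrec.nat_rec₁ (f := fun _ m => 2 * m) 1
    (Primrec.nat_double.comp Primrec.snd)).of_eq fun n => ?_
  induction n with
  | zero => rfl
  | succ n ih => rw [pow_succ, ← ih, mul_comm]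

theorem listGetD {l : (Fin k → ℕ → ℕ) → α → List ℕ} (hl : IsArithFun l) (ht : IsArithFun t) :
    IsArithFun fun f a => (l f a).getD (t f a) 0 := comp₂ (Primrec.list_getD 0) hl ht

theorem listLength {l : (Fin k → ℕ → ℕ) → α → List ℕ} (hl : IsArithFun l) :
    IsArithFun fun f a => (l f a).length := (of_primrec Primrec.list_length).comp hl

theorem listOfNat (ht : IsArithFun t) :
    IsArithFun fun f a => Denumerable.ofNat (List ℕ) (t f a) :=
  (of_primrec (Primrec.ofNat (List ℕ))).comp ht

/-- Evaluation of a family of reals that is arithmetical in the parameters. -/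
theorem eval {c : (Fin k → ℕ → ℕ) → β → ℕ → ℕ}
    (hc : IsArithFun fun f (p : β × ℕ) => c f p.1 p.2) {s : (Fin k → ℕ → ℕ) → α → β}
    (hs : IsArithFun s) (ht : IsArithFun t) : IsArithFun fun f a => c f (s f a) (t f a) :=
  hc.comp (hs.pair ht)

end IsArithFun

theorem IsArith.eq {s t : (Fin k → ℕ → ℕ) → α → β} (hs : IsArithFun s) (ht : IsArithFun t) :
    IsArith fun f a => s f a = t f a :=
  (IsArith.of_primrecPred (α := β × β) Primrec.eq).comp_fun (hs.pair ht)

theorem IsArith.lt {s t : (Fin k → ℕ → ℕ) → α → ℕ} (hs : IsArithFun s) (ht : IsArithFun t) :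
    IsArith fun f a => s f a < t f a :=
  (IsArith.of_primrecPred (α := ℕ × ℕ) Primrec.nat_lt).comp_fun (hs.pair ht)

theorem IsArith.le {s t : (Fin k → ℕ → ℕ) → α → ℕ} (hs : IsArithFun s) (ht : IsArithFun t) :
    IsArith fun f a => s f a ≤ t f a :=
  (IsArith.of_primrecPred (α := ℕ × ℕ) Primrec.nat_le).comp_fun (hs.pair ht)

theorem IsArith.isArithmetical {R : (Fin k → ℕ → ℕ) → Unit → Prop} (hR : IsArith R) :
    IsArithmetical 0 fun f _ => R f () := by
  have h := hR.subst (m := 0) (g := fun _ => ![Encodable.encode ()]) (Primrec.const _)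
  convert! h using 3 with f v
  simp only [Matrix.cons_val_fin_one, Encodable.encodek]
  exact ⟨fun h => ⟨(), trivial, h⟩, fun ⟨_, _, h⟩ => h⟩

end Arithmetical

/-! ## Reals coding conditions -/

section ConditionCodes

/-- The length of an initial segment of `ω` that contains the stem. -/
def codeBound (c : ℕ → ℕ) : ℕ := c (Nat.pair 0 0)
/-- The exponent `m*` of the coded condition. -/
def codeExponent (c : ℕ → ℕ) : ℕ := c (Nat.pair 0 1)
/-- The values of the stem and of the forbidden finite functions. -/
def codeTarget (c : ℕ → ℕ) (i : ℕ) : ℕ := c (Nat.pair 1 i)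
/-- The number `i` belongs to the domain of the stem. -/
def CodeStem (c : ℕ → ℕ) (i : ℕ) : Prop := c (Nat.pair 2 i) = 1
/-- The slot `u` is occupied by a forbidden function. -/
def CodeActive (c : ℕ → ℕ) (u : ℕ) : Prop := c (Nat.pair 3 u) = 1
/-- The size of the domain of the forbidden function in the slot `u`. -/
def codeSize (c : ℕ → ℕ) (u : ℕ) : ℕ := c (Nat.pair 4 u)
/-- An enumeration of the domain of the forbidden function in the slot `u`. -/
def codeElem (c : ℕ → ℕ) (u s : ℕ) : ℕ := c (Nat.pair 5 (Nat.pair u s))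

/-- The real `c` codes a condition. -/
def IsCondCode (n₀ n₁ : ℕ → ℕ) (k : ℕ) (c : ℕ → ℕ) : Prop :=
  (∀ i, codeTarget c i < k) ∧ (∀ b, ∃ u, b < u ∧ CodeActive c u) ∧
  (∀ u, CodeActive c u → codeExponent c ≤ (Nat.unpair u).1 ∧
    (Nat.unpair u).2 < n₁ (Nat.unpair u).1 * 2 ^ codeExponent c ∧
    n₀ (Nat.unpair u).1 ≤ 2 ^ codeExponent c * codeSize c u) ∧
  (∀ u, CodeActive c u → ∀ s, s < codeSize c u →
    ¬ (codeElem c u s < codeBound c ∧ CodeStem c (codeElem c u s))) ∧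
  (∀ u, CodeActive c u → ∀ s, s < codeSize c u → ∀ u', CodeActive c u' → ∀ s', s' < codeSize c u' →
    codeElem c u s = codeElem c u' s' → u = u' ∧ s = s')

/-- The function `z` extends the stem of the condition coded by `c`, and it does not extend the
forbidden functions in the slots less than `b`. -/
def CodeMemBelow (c : ℕ → ℕ) (b : ℕ) (z : ℕ → ℕ) : Prop :=
  (∀ i, i < codeBound c → CodeStem c i → z i = codeTarget c i) ∧
    ∀ u, u < b → CodeActive c u → ∃ s, s < codeSize c u ∧
      ¬ z (codeElem c u s) = codeTarget c (codeElem c u s)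

/-- The function `z` is a possibility of the condition coded by `c`. -/
def CodeMem (c z : ℕ → ℕ) : Prop := ∀ b, CodeMemBelow c b z

/-- Compatibility of the conditions coded by `c` and `d`, in terms of finite approximations. -/
def CodeCompat (k : ℕ) (c d : ℕ → ℕ) : Prop :=
  ∀ b : ℕ, ∃ L : List ℕ, (∀ i : ℕ, L.getD i 0 < k) ∧ CodeMemBelow c b (fun i => L.getD i 0) ∧
    CodeMemBelow d b fun i => L.getD i 0

variable {X : Type v} {k : ℕ}

/-- The set of possibilities of the condition coded by `c`. -/
def codeSet (e : X ≃ Fin k) (c : ℕ → ℕ) : Set (ℕ → X) := {η | CodeMem c fun i => e (η i)}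

theorem codeMem_iff {c z : ℕ → ℕ} : CodeMem c z ↔
    (∀ i < codeBound c, CodeStem c i → z i = codeTarget c i) ∧
    ∀ u, CodeActive c u → ∃ s < codeSize c u,
      z (codeElem c u s) ≠ codeTarget c (codeElem c u s) :=
  ⟨fun h => ⟨(h 0).1, fun u => (h (u + 1)).2 u (Nat.lt_succ_self u)⟩,
    fun h _ => ⟨h.1, fun u _ => h.2 u⟩⟩

theorem exists_code_fields (N M : ℕ) (T : ℕ → ℕ) (S A : ℕ → Prop) (Z : ℕ → ℕ) (E : ℕ → ℕ → ℕ) :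
    ∃ c : ℕ → ℕ, codeBound c = N ∧ codeExponent c = M ∧ (∀ i, codeTarget c i = T i) ∧
      (∀ i, CodeStem c i ↔ S i) ∧ (∀ u, CodeActive c u ↔ A u) ∧ (∀ u, codeSize c u = Z u) ∧
      ∀ u s, codeElem c u s = E u s := by
  classical
  refine ⟨fun n => match n.unpair.1 with
    | 0 => if n.unpair.2 = 0 then N else M
    | 1 => T n.unpair.2
    | 2 => if S n.unpair.2 then 1 else 0
    | 3 => if A n.unpair.2 then 1 else 0
    | 4 => Z n.unpair.2
    | _ => E n.unpair.2.unpair.1 n.unpair.2.unpair.2, ?_⟩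
  simp [codeBound, codeExponent, codeTarget, CodeStem, CodeActive, codeSize, codeElem]

theorem exists_enumeration (s : Finset ℕ) : ∃ f : ℕ → ℕ,
    (∀ i < s.card, ∀ j < s.card, f i = f j → i = j) ∧ ∀ x, x ∈ s ↔ ∃ i < s.card, f i = x := by
  refine ⟨fun i => if h : i < s.card then s.equivFin.symm ⟨i, h⟩ else 0, ?_, fun x => ?_⟩
  · intro i hi j hj h
    simpa [dif_pos hi, dif_pos hj] using h
  · constructor
    · intro hx
      refine ⟨s.equivFin ⟨x, hx⟩, (s.equivFin ⟨x, hx⟩).2, ?_⟩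
      simp
    · rintro ⟨i, hi, rfl⟩
      simp [dif_pos hi]

/-- The rank of a number in its level. -/
theorem IsBlockFamily.exists_rank {n₀ n₁ : ℕ → ℕ} {M : ℕ} {ℓ : ℕ → ℕ} {D : ℕ → Finset ℕ}
    (h : IsBlockFamily n₀ n₁ M ℓ D) : ∃ ρ : ℕ → ℕ, (∀ j, ρ j < n₁ (ℓ j) * 2 ^ M) ∧
      ∀ i j, ℓ i = ℓ j → ρ i = ρ j → i = j := by
  classical
  let B : ℕ → Finset ℕ := fun j => (Finset.range j).filter fun i => ℓ i = ℓ j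
  have hlt : ∀ i j, ℓ i = ℓ j → i < j → (B i).card < (B j).card := fun i j hij hlt => by
    refine Finset.card_lt_card (Finset.ssubset_iff_subset_ne.2 ⟨fun x hx => ?_, fun heq => ?_⟩)
    · simp only [B, Finset.mem_filter, Finset.mem_range] at hx ⊢
      exact ⟨hx.1.trans hlt, hx.2.trans hij⟩
    · have : i ∈ B j := Finset.mem_filter.2 ⟨Finset.mem_range.2 hlt, hij⟩
      rw [← heq] at this
      simp [B] at this
  refine ⟨fun j => (B j).card, fun j => ?_, fun i j hij hc => ?_⟩
  · have h₁ : B j ⊂ (h.finite (ℓ j)).toFinset := by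
      refine Finset.ssubset_iff_subset_ne.2 ⟨fun x hx => ?_, fun heq => ?_⟩
      · simpa using (Finset.mem_filter.1 hx).2
      · have : j ∈ B j := by
          rw [heq]
          simp
        simp [B] at this
    have h₂ := h.encard_le (ℓ j)
    rw [(h.finite _).encard_eq_coe_toFinset_card] at h₂
    exact (Finset.card_lt_card h₁).trans_le (by exact_mod_cast h₂)
  · rcases lt_trichotomy i j with h' | h' | h'
    · exact absurd hc (hlt i j hij h').ne
    · exact h'
    · exact absurd hc (hlt j i hij.symm h').ne'

/-- A forbidden function goes to the slot pairing its level with its rank in that level, so the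
bound on the number of functions per level becomes a bound on the rank. One target sequence serves
the stem and all forbidden functions, their domains being disjoint. -/
theorem Cond.exists_code [Nonempty X] {n₀ n₁ : ℕ → ℕ} (e : X ≃ Fin k)
    (p : Cond n₀ n₁ fun _ => X) : ∃ c, IsCondCode n₀ n₁ k c ∧ codeSet e c = p.pos := by
  classical
  obtain ⟨M, ℓ, hp, hM⟩ := p.exists_blocks
  obtain ⟨ρ, hρ, hinj⟩ := hp.exists_rank
  let slot : ℕ → ℕ := fun j => Nat.pair (ℓ j) (ρ j)
  have hslot : Function.Injective slot := fun i j hij => by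
    obtain ⟨h₁, h₂⟩ := Nat.pair_eq_pair.1 hij
    exact hinj i j h₁ h₂
  have hslot_inv : ∀ j, Function.invFun slot (slot j) = j := Function.leftInverse_invFun hslot
  choose enum henum hmem using fun j => exists_enumeration (p.σ j).dom
  let T : ℕ → X := fun i => if h : ∃ j, i ∈ (p.σ j).dom then (p.σ h.choose).extend i
    else p.w.extend i
  have hTw : ∀ i ∈ p.w.dom, T i = p.w.extend i := fun i hi => by
    refine dif_neg ?_
    rintro ⟨j, hj⟩
    exact Finset.disjoint_left.1 (p.disjoint_w j) hi hj
  have hTσ : ∀ j, ∀ i ∈ (p.σ j).dom, T i = (p.σ j).extend i := fun j i hi => by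
    have h : ∃ j, i ∈ (p.σ j).dom := ⟨j, hi⟩
    have hj : h.choose = j := by
      by_contra hne
      exact Finset.disjoint_left.1 (p.disjoint_σ _ _ hne) h.choose_spec hi
    simp only [T, dif_pos h, hj]
  obtain ⟨c, hN, hE, hT, hS, hA, hZ, hel⟩ := exists_code_fields (p.w.dom.sup id + 1) M
    (fun i => e (T i)) (fun i => i ∈ p.w.dom) (fun u => ∃ j, u = slot j)
    (fun u => (p.σ (Function.invFun slot u)).dom.card)
    (fun u => enum (Function.invFun slot u))
  have hZ' : ∀ j, codeSize c (slot j) = (p.σ j).dom.card := fun j => by rw [hZ, hslot_inv]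
  have hel' : ∀ j s, codeElem c (slot j) s = enum j s := fun j s => by rw [hel, hslot_inv]
  have hdom : ∀ j s, s < (p.σ j).dom.card → enum j s ∈ (p.σ j).dom := fun j s hs =>
    (hmem j _).2 ⟨s, hs, rfl⟩
  refine ⟨c, ⟨fun i => ?_, fun b => ?_, fun u hu => ?_, fun u hu s hs => ?_,
    fun u hu s hs u' hu' s' hs' heq => ?_⟩, ?_⟩
  · rw [hT]
    exact (e (T i)).2
  · obtain ⟨_, ⟨j, rfl⟩, hj⟩ := (infinite_range_of_injective hslot).exists_gt b
    exact ⟨slot j, hj, (hA _).2 ⟨j, rfl⟩⟩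
  · obtain ⟨j, rfl⟩ := (hA u).1 hu
    rw [hE, hZ']
    simp only [slot, Nat.unpair_pair]
    exact ⟨hM j, hρ j, hp.le_card j⟩
  · obtain ⟨j, rfl⟩ := (hA u).1 hu
    rw [hZ'] at hs
    rw [hel', hS]
    rintro ⟨-, h⟩
    exact Finset.disjoint_left.1 (p.disjoint_w j) h (hdom j s hs)
  · obtain ⟨j, rfl⟩ := (hA u).1 hu
    obtain ⟨j', rfl⟩ := (hA u').1 hu'
    rw [hZ'] at hs hs'
    rw [hel', hel'] at heq
    have hj : j = j' := by
      by_contra hne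
      exact Finset.disjoint_left.1 (p.disjoint_σ _ _ hne) (hdom j s hs) (heq ▸ hdom j' s' hs')
    subst hj
    exact ⟨rfl, henum j s hs s' hs' heq⟩
  · rw [p.pos_eq]
    ext η
    simp only [codeSet, condSet, Set.mem_ofPred_eq, codeMem_iff, hN, hT, hS]
    have hval : ∀ i, ((e (η i) : ℕ) = e (T i)) ↔ η i = T i := fun i => by
      rw [← Fin.ext_iff, e.apply_eq_iff_eq]
    simp only [ne_eq, hval]
    constructor
    · rintro ⟨h₁, h₂⟩
      refine ⟨fun x hx => ?_, fun j => ?_⟩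
      · rw [← hTw x hx]
        exact h₁ x (Nat.lt_succ_of_le (Finset.le_sup (f := id) hx)) hx
      · obtain ⟨s, hs, hne⟩ := h₂ (slot j) ((hA _).2 ⟨j, rfl⟩)
        rw [hZ'] at hs
        rw [hel', hTσ j _ (hdom j s hs)] at hne
        exact ⟨_, hdom j s hs, hne⟩
    · rintro ⟨h₁, h₂⟩
      refine ⟨fun x _ hx => by rw [h₁ x hx, hTw x hx], fun u hu => ?_⟩
      obtain ⟨j, rfl⟩ := (hA u).1 hu
      obtain ⟨x, hx, hne⟩ := h₂ j
      obtain ⟨s, hs, rfl⟩ := (hmem j x).1 hx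
      rw [← hTσ j _ hx] at hne
      exact ⟨s, by rwa [hZ'], by rwa [hel']⟩

theorem IsCondCode.exists_cond {n₀ n₁ : ℕ → ℕ} (e : X ≃ Fin k) {c : ℕ → ℕ}
    (hc : IsCondCode n₀ n₁ k c) : ∃ p : Cond n₀ n₁ fun _ => X, p.pos = codeSet e c := by
  classical
  obtain ⟨hT, hinf, hA, hS, hinj⟩ := hc
  let D : {u // CodeActive c u} → Finset ℕ := fun u =>
    (Finset.range (codeSize c u)).image (codeElem c u)
  have : Infinite {u // CodeActive c u} :=
    infinite_coe_iff.2 (infinite_of_forall_exists_gt fun b => by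
      obtain ⟨u, hu, hu'⟩ := hinf b
      exact ⟨u, hu', hu⟩)
  have hD : IsBlockFamily n₀ n₁ (codeExponent c) (fun u => (Nat.unpair u.1).1) D := by
    refine ⟨fun m => ?_, fun u => ?_⟩
    · rw [← Finset.card_range (n₁ m * 2 ^ codeExponent c), ← Set.encard_coe_eq_coe_finsetCard]
      refine Set.encard_le_encard_of_injOn (f := fun u => (Nat.unpair u.1).2) ?_ ?_
      · rintro u rfl
        simpa using (hA u.1 u.2).2.1
      · intro u hu u' hu' h
        have h' : (Nat.unpair u.1).1 = (Nat.unpair u'.1).1 := Eq.trans hu hu'.symm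
        rw [Subtype.ext_iff, ← Nat.pair_unpair u.1, ← Nat.pair_unpair u'.1, h']
        exact congrArg (Nat.pair _) h
    · rw [Finset.card_image_of_injOn, Finset.card_range]
      · exact (hA u.1 u.2).2.2
      · intro s hs s' hs' h
        exact (hinj u u.2 s (by simpa using hs) u u.2 s' (by simpa using hs') h).2
  obtain ⟨p, hp⟩ := exists_cond_pos_eq (H := fun _ => X) hD (fun u => (hA u.1 u.2).1)
    (W := (Finset.range (codeBound c)).filter (CodeStem c))
    (fun u u' hne => by
      rw [Finset.disjoint_left]
      intro x hx hx'
      simp only [D, Finset.mem_image, Finset.mem_range] at hx hx'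
      obtain ⟨s, hs, rfl⟩ := hx
      obtain ⟨s', hs', h⟩ := hx'
      exact hne (Subtype.ext (hinj u u.2 s hs u' u'.2 s' hs' h.symm).1))
    (fun u => by
      rw [Finset.disjoint_left]
      intro x hx hx'
      simp only [D, Finset.mem_image, Finset.mem_range, Finset.mem_filter] at hx hx'
      obtain ⟨s, hs, rfl⟩ := hx'
      exact hS u u.2 s hs hx)
    (fun i => e.symm ⟨codeTarget c i, hT i⟩) (fun _ i => e.symm ⟨codeTarget c i, hT i⟩)
  refine ⟨p, hp.trans ?_⟩
  have hval : ∀ (η : ℕ → X) i, η i = e.symm ⟨codeTarget c i, hT i⟩ ↔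
      (e (η i) : ℕ) = codeTarget c i := fun η i => by
    rw [Equiv.eq_symm_apply, Fin.ext_iff]
  ext η
  simp only [codeSet, condSet, Set.mem_ofPred_eq, codeMem_iff, ne_eq, hval, Finset.mem_filter,
    Finset.mem_range, and_imp, Subtype.forall, D, Finset.mem_image, exists_exists_and_eq_and]

theorem posFamily_eq_range_codeSet [Nonempty X] {n₀ n₁ : ℕ → ℕ} (e : X ≃ Fin k) :
    posFamily n₀ n₁ (fun _ => X) = {A | ∃ c, IsCondCode n₀ n₁ k c ∧ codeSet e c = A} := by
  ext A
  constructor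
  · rintro ⟨p, rfl⟩
    exact p.exists_code e
  · rintro ⟨c, hc, rfl⟩
    exact hc.exists_cond e

/-- Locality of the approximations: this makes them closed conditions on `z` and lets finite lists
replace `z`. -/
theorem codeMemBelow_congr {c : ℕ → ℕ} {b : ℕ} {z z' : ℕ → ℕ} {L : ℕ} (hN : codeBound c ≤ L)
    (hL : ∀ u < b, ∀ s < codeSize c u, codeElem c u s < L) (hz : ∀ i < L, z i = z' i)
    (h : CodeMemBelow c b z) : CodeMemBelow c b z' := by
  refine ⟨fun i hi hS => by rw [← hz i (hi.trans_le hN)]; exact h.1 i hi hS, fun u hu hA => ?_⟩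
  obtain ⟨s, hs, hne⟩ := h.2 u hu hA
  exact ⟨s, hs, by rwa [← hz _ (hL u hu s hs)]⟩

theorem exists_code_length (c : ℕ → ℕ) (b : ℕ) : ∃ L, codeBound c ≤ L ∧
    ∀ u < b, ∀ s < codeSize c u, codeElem c u s < L := by
  refine ⟨codeBound c + ((Finset.range b).sup fun u =>
    (Finset.range (codeSize c u)).sup (codeElem c u)) + 1, by omega, fun u hu s hs => ?_⟩
  have h₁ : codeElem c u s ≤ (Finset.range (codeSize c u)).sup (codeElem c u) :=
    Finset.le_sup (f := codeElem c u) (Finset.mem_range.2 hs)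
  have h₂ := Finset.le_sup (f := fun u => (Finset.range (codeSize c u)).sup (codeElem c u))
    (Finset.mem_range.2 hu)
  omega

theorem isClosed_codeMemBelow [TopologicalSpace X] [DiscreteTopology X] (e : X ≃ Fin k)
    (c : ℕ → ℕ) (b : ℕ) : IsClosed {η : ℕ → X | CodeMemBelow c b fun i => e (η i)} := by
  obtain ⟨L, hN, hL⟩ := exists_code_length c b
  have hcl : ∀ η : ℕ → X, IsOpen (Set.pi (Finset.range L : Set ℕ) fun i => {η i}) := fun η =>
    isOpen_set_pi (Finset.finite_toSet _) fun _ _ => isOpen_discrete _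
  rw [← isOpen_compl_iff, isOpen_iff_mem_nhds]
  intro η hη
  refine mem_of_superset ((hcl η).mem_nhds fun i _ => rfl) fun ζ hζ hmem => hη ?_
  refine codeMemBelow_congr hN hL (fun i hi => ?_) hmem
  have : ζ i = η i := hζ i (by simpa using hi)
  simp only [this]

/-- Compactness of X^ω turns the existence of a common possibility, a quantifier over reals, into an
arithmetical statement; the converse truncates a common possibility. -/
theorem codeCompat_iff [Nonempty X] (e : X ≃ Fin k) {c d : ℕ → ℕ} :
    CodeCompat k c d ↔ (codeSet e c ∩ codeSet e d).Nonempty := by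
  have hk : 0 < k := (e (Classical.arbitrary X)).pos
  constructor
  · intro h
    let : TopologicalSpace X := ⊥
    have : DiscreteTopology X := ⟨rfl⟩
    have : Finite X := Finite.of_equiv _ e.symm
    let K : ℕ → Set (ℕ → X) := fun b =>
      {η | CodeMemBelow c b fun i => e (η i)} ∩ {η | CodeMemBelow d b fun i => e (η i)}
    have hKcl : ∀ b, IsClosed (K b) := fun b =>
      (isClosed_codeMemBelow e c b).inter (isClosed_codeMemBelow e d b)
    have hne : (⋂ b, K b).Nonempty := by
      refine IsCompact.nonempty_iInter_of_sequence_nonempty_isCompact_isClosed K (fun b => ?_)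
        (fun b => ?_) (hKcl 0).isCompact hKcl
      · exact fun η hη => ⟨⟨hη.1.1, fun u hu => hη.1.2 u (hu.trans (Nat.lt_succ_self b))⟩,
          ⟨hη.2.1, fun u hu => hη.2.2 u (hu.trans (Nat.lt_succ_self b))⟩⟩
      · obtain ⟨L, hL, h₁, h₂⟩ := h b
        refine ⟨fun i => e.symm ⟨L.getD i 0, hL i⟩, ?_, ?_⟩
        · simpa using h₁
        · simpa using h₂
    obtain ⟨η, hη⟩ := hne
    rw [mem_iInter] at hη
    exact ⟨η, fun b => (hη b).1, fun b => (hη b).2⟩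
  · rintro ⟨η, hc, hd⟩ b
    obtain ⟨L, hN, hL⟩ := exists_code_length c b
    obtain ⟨L', hN', hL'⟩ := exists_code_length d b
    have hget : ∀ i < L + L', ((e (η i) : Fin k) : ℕ) =
        ((List.range (L + L')).map fun i => (e (η i) : ℕ)).getD i 0 := fun i hi => by
      simp [List.getD_eq_getElem?_getD, hi]
    refine ⟨(List.range (L + L')).map fun i => (e (η i) : ℕ), fun i => ?_, ?_, ?_⟩
    · by_cases hi : i < L + L'
      · rw [← hget i hi]
        exact (e (η i)).2
      -- Past the end of the list the default value 0 is read, which is admissible as `X` is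
      -- non-empty.
      · rw [List.getD_eq_default _ _ (by simpa using hi)]
        exact hk
    · exact codeMemBelow_congr hN hL (fun i hi => hget i (by omega)) (hc b)
    · exact codeMemBelow_congr hN' hL' (fun i hi => hget i (by omega)) (hd b)

end ConditionCodes

/-! ## Evaluation of Borel codes -/

section BorelCodes

/-- The index, in a code, of the `n`-th entry of the code attached to a node of its tree. Nodes
are finite sequences, last step first: the step `0` leads to the code of a set of which the
complement is taken, and the step `i + 1` to the `i`-th set in a union. -/
def nodeIndex (s : List ℕ) (n : ℕ) : ℕ :=
  s.foldl (fun n a => if a = 0 then n + 1 else Nat.pair (a - 1) n + 1) n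

/-- The code attached to the node with the number `m`. -/
def nodeCode (r : ℕ → ℕ) (m n : ℕ) : ℕ := r (nodeIndex (Denumerable.ofNat (List ℕ) m) n)

/-- The number of the node reached by the step `a` from the node with the number `m`. -/
def childNode (a m : ℕ) : ℕ := Nat.pair a m + 1

/-- The root has number 0, the code of the empty list; `Nat.pair a m + 1` is the code of `a ::` the
list with number `m`. -/
theorem nodeCode_zero (r : ℕ → ℕ) : nodeCode r 0 = r := by
  funext n
  simp [nodeCode, nodeIndex]

theorem nodeCode_child_zero (r : ℕ → ℕ) (m : ℕ) :
    nodeCode r (childNode 0 m) = fun n => nodeCode r m (n + 1) := by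
  funext n
  simp [nodeCode, nodeIndex, childNode]

theorem nodeCode_child_succ (r : ℕ → ℕ) (i m : ℕ) :
    nodeCode r (childNode (i + 1) m) = fun n => nodeCode r m (Nat.pair i n + 1) := by
  funext n
  simp [nodeCode, nodeIndex, childNode]

/-- The node with the number `m'` is reached by a step from the node with the number `m`. -/
def IsNodeStep (r : ℕ → ℕ) (m m' : ℕ) : Prop :=
  (nodeCode r m 0 = 0 ∧ m' = childNode 0 m) ∨
    (nodeCode r m 0 = 1 ∧ ∃ i, m' = childNode (i + 1) m)

/-- The sequence `y` is an infinite branch of the tree of `r`. -/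
def IsNodeBranch (r y : ℕ → ℕ) : Prop := y 0 = 0 ∧ ∀ n, IsNodeStep r (y n) (y (n + 1))

/-- The sequence `z` extends the finite sequence with the number `n`. -/
def ExtendsList (z : ℕ → ℕ) (n : ℕ) : Prop :=
  ∀ i, i < (Denumerable.ofNat (List ℕ) n).length → z i = (Denumerable.ofNat (List ℕ) n).getD i 0

/-- The function `E` is a correct assignment of truth values (`1` for true, `2` for undefined) to
the statements that `z` belongs to the sets coded at the nodes of the tree of `r`, defined at the
root. -/
def IsValuation (r z E : ℕ → ℕ) : Prop :=
  ¬ E 0 = 2 ∧ ∀ m, ¬ E m = 2 →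
    (2 ≤ nodeCode r m 0 → (E m = 1 ↔ ∃ n, nodeCode r m (n + 1) = 1 ∧ ExtendsList z n)) ∧
    (nodeCode r m 0 = 0 → ¬ E (childNode 0 m) = 2 ∧ (E m = 1 ↔ ¬ E (childNode 0 m) = 1)) ∧
    (nodeCode r m 0 = 1 → (∀ i, ¬ E (childNode (i + 1) m) = 2) ∧
      (E m = 1 ↔ ∃ i, E (childNode (i + 1) m) = 1))

/-! ### Valuations and well-foundedness of the code tree -/

variable {X : Type v} {k : ℕ} {e : X ≃ Fin k}

theorem mem_basicClopen_iff {η : ℕ → X} {n : ℕ} :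
    η ∈ basicClopen e n ↔ ExtendsList (fun i => e (η i)) n := by
  simp only [basicClopen, ExtendsList, Set.mem_ofPred_eq]
  refine forall₂_congr fun i hi => ?_
  rw [List.getD_eq_getElem _ _ hi]

/-- By induction on the code, a valuation has no freedom at the nodes where it is defined. Hence
membership in the coded set can be tested with any valuation. -/
theorem IsValuation.eq_one_iff {r : ℕ → ℕ} {η : ℕ → X} {E : ℕ → ℕ}
    (hE : IsValuation r (fun i => e (η i)) E) {r' : ℕ → ℕ} {A : Set (ℕ → X)}
    (h : IsBorelCode e r' A) : ∀ m, nodeCode r m = r' → E m ≠ 2 → (E m = 1 ↔ η ∈ A) := by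
  induction h with
  | basic r' hr =>
    rintro m rfl hm
    rw [(hE.2 m hm).1 hr]
    simp [mem_basicClopen_iff]
  | compl r' hr A _ ih =>
    rintro m rfl hm
    obtain ⟨h₁, h₂⟩ := (hE.2 m hm).2.1 hr
    rw [h₂, ih _ (nodeCode_child_zero r m) h₁]
    rfl
  | union r' hr A _ ih =>
    rintro m rfl hm
    obtain ⟨h₁, h₂⟩ := (hE.2 m hm).2.2 hr
    rw [h₂, mem_iUnion]
    exact exists_congr fun i => ih i _ (nodeCode_child_succ r i m) (h₁ i)

theorem IsBorelCode.unique {r : ℕ → ℕ} {A B : Set (ℕ → X)} (hA : IsBorelCode e r A)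
    (hB : IsBorelCode e r B) : A = B := by
  induction hA generalizing B with
  | basic r hr =>
    cases hB with
    | basic => rfl
    | compl _ h => omega
    | union _ h => omega
  | compl r hr A _ ih =>
    cases hB with
    | basic _ h => omega
    | compl _ _ B hB => rw [ih hB]
    | union _ h => omega
  | union r hr A _ ih =>
    cases hB with
    | basic _ h => omega
    | compl _ h => omega
    | union _ _ B hB => exact congrArg _ (funext fun i => ih i (hB i))

theorem IsBorelCode.exists_children {r : ℕ → ℕ} {A : Set (ℕ → X)} (h : IsBorelCode e r A) :
    (r 0 = 0 → ∃ B, IsBorelCode e (fun n => r (n + 1)) B ∧ A = Bᶜ) ∧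
    (r 0 = 1 → ∃ B : ℕ → Set (ℕ → X), (∀ i, IsBorelCode e (fun n => r (Nat.pair i n + 1)) (B i)) ∧
      A = ⋃ i, B i) ∧
    (2 ≤ r 0 → A = ⋃ n ∈ {n : ℕ | r (n + 1) = 1}, basicClopen e n) := by
  cases h with
  | basic _ h => exact ⟨fun h' => by omega, fun h' => by omega, fun _ => rfl⟩
  | compl _ h B hB => exact ⟨fun _ => ⟨B, hB, rfl⟩, fun h' => by omega, fun h' => by omega⟩
  | union _ h B hB => exact ⟨fun h' => by omega, fun _ => ⟨B, hB, rfl⟩, fun h' => by omega⟩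

/-- The valuation is defined at exactly those nodes that carry Borel codes, and gives the truth
value of membership there; uniqueness of the coded set makes this consistent. -/
theorem IsBorelCode.exists_valuation {r : ℕ → ℕ} {A : Set (ℕ → X)} (h : IsBorelCode e r A)
    (η : ℕ → X) : ∃ E, IsValuation r (fun i => e (η i)) E := by
  classical
  let E : ℕ → ℕ := fun m => if ∃ B, IsBorelCode e (nodeCode r m) B ∧ η ∈ B then 1
    else if ∃ B, IsBorelCode e (nodeCode r m) B then 0 else 2
  have h₁ : ∀ m B, IsBorelCode e (nodeCode r m) B → (E m = 1 ↔ η ∈ B) := by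
    intro m B hB
    by_cases hη : η ∈ B
    · simp only [hη, iff_true]
      exact if_pos ⟨B, hB, hη⟩
    · simp only [hη, iff_false]
      have hn : ¬ ∃ B, IsBorelCode e (nodeCode r m) B ∧ η ∈ B := by
        rintro ⟨B', hB', hη'⟩
        exact hη (hB.unique hB' ▸ hη')
      simp only [E, if_neg hn]
      split_ifs <;> simp
  have h₂ : ∀ m, E m ≠ 2 ↔ ∃ B, IsBorelCode e (nodeCode r m) B := by
    intro m
    constructor
    · intro hm
      by_contra hn
      refine hm ?_
      simp only [E]
      rw [if_neg fun ⟨B, hB, _⟩ => hn ⟨B, hB⟩, if_neg hn]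
    · rintro ⟨B, hB⟩
      simp only [E]
      split_ifs with h h'
      · simp
      · simp
      · exact absurd ⟨B, hB⟩ h'
  refine ⟨E, (h₂ 0).2 ⟨A, by rwa [nodeCode_zero]⟩, fun m hm => ?_⟩
  obtain ⟨B, hB⟩ := (h₂ m).1 hm
  obtain ⟨hc, hu, hb⟩ := hB.exists_children
  refine ⟨fun hr => ?_, fun hr => ?_, fun hr => ?_⟩
  · rw [h₁ m B hB, hb hr]
    simp [mem_basicClopen_iff]
  · obtain ⟨B', hB', rfl⟩ := hc hr
    rw [← nodeCode_child_zero] at hB'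
    exact ⟨(h₂ _).2 ⟨B', hB'⟩, by rw [h₁ m _ hB, h₁ _ _ hB']; rfl⟩
  · obtain ⟨B', hB', rfl⟩ := hu hr
    have hB'' : ∀ i, IsBorelCode e (nodeCode r (childNode (i + 1) m)) (B' i) := fun i => by
      rw [nodeCode_child_succ]
      exact hB' i
    refine ⟨fun i => (h₂ _).2 ⟨_, hB'' i⟩, ?_⟩
    rw [h₁ m _ hB, mem_iUnion]
    exact exists_congr fun i => (h₁ _ _ (hB'' i)).symm

theorem IsBorelCode.not_branch {r r' : ℕ → ℕ} {A : Set (ℕ → X)} (h : IsBorelCode e r' A) :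
    ∀ y : ℕ → ℕ, nodeCode r (y 0) = r' → ¬ ∀ n, IsNodeStep r (y n) (y (n + 1)) := by
  induction h with
  | basic r' hr =>
    rintro y rfl hy
    rcases hy 0 with ⟨h, -⟩ | ⟨h, -⟩ <;> omega
  | compl r' hr A _ ih =>
    rintro y rfl hy
    rcases hy 0 with ⟨-, h⟩ | ⟨h, -⟩
    · refine ih (fun n => y (n + 1)) ?_ fun n => hy (n + 1)
      rw [h, nodeCode_child_zero]
    · omega
  | union r' hr A _ ih =>
    rintro y rfl hy
    rcases hy 0 with ⟨h, -⟩ | ⟨-, i, h⟩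
    · omega
    · refine ih i (fun n => y (n + 1)) ?_ fun n => hy (n + 1)
      rw [h, nodeCode_child_succ]

/-- Replaces the inductive definition by a single universal real quantifier. If a node does not
carry a Borel code, neither does some child, so dependent choice produces a branch. -/
theorem exists_isBorelCode_iff (e : X ≃ Fin k) {r : ℕ → ℕ} :
    (∃ A, IsBorelCode e r A) ↔ ∀ y, ¬ IsNodeBranch r y := by
  constructor
  · rintro ⟨A, hA⟩ y ⟨h₀, hy⟩
    exact hA.not_branch y (by rw [h₀, nodeCode_zero]) hy
  · intro h
    by_contra hn
    have step : ∀ m : {m // ¬ ∃ A, IsBorelCode e (nodeCode r m) A},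
        ∃ m' : {m // ¬ ∃ A, IsBorelCode e (nodeCode r m) A}, IsNodeStep r m m' := by
      rintro ⟨m, hm⟩
      rcases hr : nodeCode r m 0 with _ | _ | j
      · refine ⟨⟨childNode 0 m, ?_⟩, Or.inl ⟨hr, rfl⟩⟩
        rintro ⟨A, hA⟩
        rw [nodeCode_child_zero] at hA
        exact hm ⟨_, .compl _ hr _ hA⟩
      · by_contra hcon
        have : ∀ i, ∃ A, IsBorelCode e (nodeCode r (childNode (i + 1) m)) A := fun i => by
          by_contra hi
          exact hcon ⟨⟨_, hi⟩, Or.inr ⟨hr, i, rfl⟩⟩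
        choose A hA using this
        simp only [nodeCode_child_succ] at hA
        exact hm ⟨_, .union _ hr A hA⟩
      · exact absurd ⟨_, .basic _ (by omega)⟩ hm
    choose g hg using step
    let y : ℕ → {m // ¬ ∃ A, IsBorelCode e (nodeCode r m) A} := fun n =>
      Nat.rec ⟨0, by rwa [nodeCode_zero]⟩ (fun _ m => g m) n
    exact h (fun n => (y n).1) ⟨rfl, fun n => hg (y n)⟩

end BorelCodes

/-! ## The complexity of the ideal -/

section Complexity

variable {k : ℕ} {α β : Type} [Primcodable α] [Primcodable β]
  {n₀ n₁ c d z r E : (Fin k → ℕ → ℕ) → α → ℕ → ℕ}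

theorem isArith_isCondCode (h₀ : IsArithFun fun f (p : α × ℕ) => n₀ f p.1 p.2)
    (h₁ : IsArithFun fun f (p : α × ℕ) => n₁ f p.1 p.2)
    (hc : IsArithFun fun f (p : α × ℕ) => c f p.1 p.2) (K : ℕ) :
    IsArith fun f a => IsCondCode (n₀ f a) (n₁ f a) K (c f a) := by
  simp only [IsCondCode, codeTarget, codeBound, codeExponent, CodeStem, CodeActive, codeSize,
    codeElem]
  -- The formula is taken apart along its syntax down to evaluations of the given reals.
  repeat' first
    | with_reducible exact IsArithFun.const _
    | with_reducible exact IsArithFun.id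
    | with_reducible apply IsArith.and
    | with_reducible apply IsArith.not
    | with_reducible apply IsArith.imp
    | with_reducible apply IsArith.all
    | with_reducible apply IsArith.ex
    | with_reducible apply IsArith.lt
    | with_reducible apply IsArith.le
    | with_reducible apply IsArith.eq
    | with_reducible apply IsArithFun.fst
    | with_reducible apply IsArithFun.snd
    | with_reducible apply IsArithFun.natPair
    | with_reducible apply IsArithFun.natUnpair
    | with_reducible apply IsArithFun.two_pow
    | with_reducible apply IsArithFun.mul
    | with_reducible apply IsArithFun.eval hc
    | with_reducible apply IsArithFun.eval h₀
    | with_reducible apply IsArithFun.eval h₁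

theorem isArith_codeMemBelow (hc : IsArithFun fun f (p : α × ℕ) => c f p.1 p.2)
    (hz : IsArithFun fun f (p : α × ℕ) => z f p.1 p.2) {b : (Fin k → ℕ → ℕ) → α → ℕ}
    (hb : IsArithFun b) : IsArith fun f a => CodeMemBelow (c f a) (b f a) (z f a) := by
  have hb' : IsArithFun fun f (p : α × ℕ) => b f p.1 := hb.comp (IsArithFun.id.fst)
  simp only [CodeMemBelow, codeTarget, codeBound, CodeStem, CodeActive, codeSize, codeElem]
  repeat' first
    | with_reducible exact IsArithFun.const _
    | with_reducible exact IsArithFun.id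
    | with_reducible exact hb'
    | with_reducible apply IsArith.and
    | with_reducible apply IsArith.not
    | with_reducible apply IsArith.imp
    | with_reducible apply IsArith.all
    | with_reducible apply IsArith.ex
    | with_reducible apply IsArith.lt
    | with_reducible apply IsArith.eq
    | with_reducible apply IsArithFun.fst
    | with_reducible apply IsArithFun.snd
    | with_reducible apply IsArithFun.natPair
    | with_reducible apply IsArithFun.eval hc
    | with_reducible apply IsArithFun.eval hz

theorem IsArithFun.comp_fst (hc : IsArithFun fun f (p : α × ℕ) => c f p.1 p.2) :
    IsArithFun fun f (p : (α × β) × ℕ) => c f p.1.1 p.2 :=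
  IsArithFun.eval hc IsArithFun.id.fst.fst IsArithFun.id.snd

theorem isArith_codeMem (hc : IsArithFun fun f (p : α × ℕ) => c f p.1 p.2)
    (hz : IsArithFun fun f (p : α × ℕ) => z f p.1 p.2) :
    IsArith fun f a => CodeMem (c f a) (z f a) :=
  IsArith.all (isArith_codeMemBelow (c := fun f (p : α × ℕ) => c f p.1)
    (z := fun f (p : α × ℕ) => z f p.1) hc.comp_fst hz.comp_fst IsArithFun.id.snd)

theorem isArith_codeCompat (hc : IsArithFun fun f (p : α × ℕ) => c f p.1 p.2)
    (hd : IsArithFun fun f (p : α × ℕ) => d f p.1 p.2) (K : ℕ) :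
    IsArith fun f a => CodeCompat K (c f a) (d f a) := by
  refine IsArith.all (IsArith.ex (IsArith.and (IsArith.all ?_) (IsArith.and ?_ ?_)))
  · exact IsArith.lt (IsArithFun.listGetD IsArithFun.id.fst.snd IsArithFun.id.snd)
      (IsArithFun.const K)
  · exact isArith_codeMemBelow (c := fun f (p : (α × ℕ) × List ℕ) => c f p.1.1)
      (z := fun f (p : (α × ℕ) × List ℕ) i => p.2.getD i 0)
      (IsArithFun.comp_fst (c := fun f (p : α × ℕ) => c f p.1) hc.comp_fst)
      (IsArithFun.listGetD IsArithFun.id.fst.snd IsArithFun.id.snd) IsArithFun.id.fst.snd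
  · exact isArith_codeMemBelow (c := fun f (p : (α × ℕ) × List ℕ) => d f p.1.1)
      (z := fun f (p : (α × ℕ) × List ℕ) i => p.2.getD i 0)
      (IsArithFun.comp_fst (c := fun f (p : α × ℕ) => d f p.1) hd.comp_fst)
      (IsArithFun.listGetD IsArithFun.id.fst.snd IsArithFun.id.snd) IsArithFun.id.fst.snd

theorem primrec₂_nodeIndex : Primrec₂ nodeIndex := by
  have hstep : Primrec₂ fun (_ : List ℕ × ℕ) (q : ℕ × ℕ) =>
      if q.2 = 0 then q.1 + 1 else Nat.pair (q.2 - 1) q.1 + 1 := by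
    have h₁ : Primrec fun q : (List ℕ × ℕ) × ℕ × ℕ => q.2.1 := Primrec.fst.comp Primrec.snd
    have h₂ : Primrec fun q : (List ℕ × ℕ) × ℕ × ℕ => q.2.2 := Primrec.snd.comp Primrec.snd
    exact Primrec.ite (Primrec.eq.comp h₂ (Primrec.const 0)) (Primrec.succ.comp h₁)
      (Primrec.succ.comp (Primrec₂.natPair.comp (Primrec.pred.comp h₂) h₁))
  exact Primrec.list_foldl Primrec.fst Primrec.snd hstep

theorem IsArithFun.nodeCode (hr : IsArithFun fun f (p : α × ℕ) => r f p.1 p.2)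
    {s : (Fin k → ℕ → ℕ) → β → α} (hs : IsArithFun s) {m t : (Fin k → ℕ → ℕ) → β → ℕ}
    (hm : IsArithFun m) (ht : IsArithFun t) :
    IsArithFun fun f b => nodeCode (r f (s f b)) (m f b) (t f b) :=
  hr.eval hs (IsArithFun.comp₂ primrec₂_nodeIndex hm.listOfNat ht)

theorem IsArithFun.childNode {s t : (Fin k → ℕ → ℕ) → α → ℕ} (hs : IsArithFun s)
    (ht : IsArithFun t) : IsArithFun fun f a => childNode (s f a) (t f a) :=
  (hs.natPair ht).add (IsArithFun.const 1)

theorem isArith_isNodeBranch (hr : IsArithFun fun f (p : α × ℕ) => r f p.1 p.2)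
    (hz : IsArithFun fun f (p : α × ℕ) => z f p.1 p.2) :
    IsArith fun f a => IsNodeBranch (r f a) (z f a) := by
  simp only [IsNodeBranch, IsNodeStep]
  repeat' first
    | with_reducible exact IsArithFun.const _
    | with_reducible exact IsArithFun.id
    | with_reducible apply IsArith.and
    | with_reducible apply IsArith.or
    | with_reducible apply IsArith.all
    | with_reducible apply IsArith.ex
    | with_reducible apply IsArith.eq
    | with_reducible apply IsArithFun.fst
    | with_reducible apply IsArithFun.snd
    | with_reducible apply IsArithFun.add
    | with_reducible apply IsArithFun.childNode
    | with_reducible apply IsArithFun.nodeCode hr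
    | with_reducible apply IsArithFun.eval hz

theorem isArith_isValuation (hr : IsArithFun fun f (p : α × ℕ) => r f p.1 p.2)
    (hz : IsArithFun fun f (p : α × ℕ) => z f p.1 p.2)
    (hE : IsArithFun fun f (p : α × ℕ) => E f p.1 p.2) :
    IsArith fun f a => IsValuation (r f a) (z f a) (E f a) := by
  simp only [IsValuation, ExtendsList]
  repeat' first
    | with_reducible exact IsArithFun.const _
    | with_reducible exact IsArithFun.id
    | with_reducible apply IsArith.and
    | with_reducible apply IsArith.not
    | with_reducible apply IsArith.iff
    | with_reducible apply IsArith.imp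
    | with_reducible apply IsArith.all
    | with_reducible apply IsArith.ex
    | with_reducible apply IsArith.lt
    | with_reducible apply IsArith.le
    | with_reducible apply IsArith.eq
    | with_reducible apply IsArithFun.fst
    | with_reducible apply IsArithFun.snd
    | with_reducible apply IsArithFun.add
    | with_reducible apply IsArithFun.listLength
    | with_reducible apply IsArithFun.listGetD
    | with_reducible apply IsArithFun.listOfNat
    | with_reducible apply IsArithFun.childNode
    | with_reducible apply IsArithFun.nodeCode hr
    | with_reducible apply IsArithFun.eval hz
    | with_reducible apply IsArithFun.eval hE

/-- The matrix of the formula saying that `r` is a Borel code of a meager set: the real `x` codes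
countably many families of conditions, and the real `y` does not refute that each of them is
predense, that `r` is a Borel code, and that the coded set is disjoint from the intersection of
the unions of the families. -/
def MeagerMatrix (K : ℕ) (n₀ n₁ r x y : ℕ → ℕ) : Prop :=
  (∀ n j, IsCondCode n₀ n₁ K fun i => x (Nat.pair (Nat.pair n j) i)) ∧
  (IsCondCode n₀ n₁ K y → ∀ n, ∃ j, CodeCompat K y fun i => x (Nat.pair (Nat.pair n j) i)) ∧
  ¬ IsNodeBranch r y ∧
  ((∀ i, y (2 * i) < K) → IsValuation r (fun i => y (2 * i)) (fun i => y (2 * i + 1)) →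
    (∀ n, ∃ j, CodeMem (fun i => x (Nat.pair (Nat.pair n j) i)) fun i => y (2 * i)) →
      ¬ y (2 * 0 + 1) = 1)

theorem isArith_meagerMatrix (K : ℕ) : IsArith fun (f : Fin 5 → ℕ → ℕ) (_ : Unit) =>
    MeagerMatrix K (f 0) (f 1) (f 2) (f 3) (f 4) := by
  have hreal : ∀ (i : Fin 5) {β : Type} [Primcodable β],
      IsArithFun fun (f : Fin 5 → ℕ → ℕ) (p : β × ℕ) => f i p.2 := fun i _ _ =>
    IsArithFun.apply_real i IsArithFun.id.snd
  have hx : IsArithFun fun (f : Fin 5 → ℕ → ℕ) (p : ((Unit × ℕ) × ℕ) × ℕ) =>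
      f 3 (Nat.pair (Nat.pair p.1.1.2 p.1.2) p.2) :=
    IsArithFun.apply_real 3 ((IsArithFun.natPair IsArithFun.id.fst.fst.snd
      IsArithFun.id.fst.snd).natPair IsArithFun.id.snd)
  have hz : ∀ {β : Type} [Primcodable β],
      IsArithFun fun (f : Fin 5 → ℕ → ℕ) (p : β × ℕ) => f 4 (2 * p.2) := fun {_} _ =>
    IsArithFun.apply_real 4 ((IsArithFun.const 2).mul IsArithFun.id.snd)
  have hE : IsArithFun fun (f : Fin 5 → ℕ → ℕ) (p : Unit × ℕ) => f 4 (2 * p.2 + 1) :=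
    IsArithFun.apply_real 4 (((IsArithFun.const 2).mul IsArithFun.id.snd).add (IsArithFun.const 1))
  refine IsArith.and ?_ (IsArith.and ?_ (IsArith.and ?_ ?_))
  · exact IsArith.all (IsArith.all (isArith_isCondCode (n₀ := fun f _ => f 0)
      (n₁ := fun f _ => f 1) (c := fun f (p : (Unit × ℕ) × ℕ) i =>
        f 3 (Nat.pair (Nat.pair p.1.2 p.2) i)) (hreal 0) (hreal 1) hx K))
  · exact IsArith.imp (isArith_isCondCode (n₀ := fun f _ => f 0) (n₁ := fun f _ => f 1)
      (c := fun f _ => f 4) (hreal 0) (hreal 1) (hreal 4) K)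
      (IsArith.all (IsArith.ex (isArith_codeCompat (c := fun f _ => f 4)
        (d := fun f (p : (Unit × ℕ) × ℕ) i => f 3 (Nat.pair (Nat.pair p.1.2 p.2) i))
        (hreal 4) hx K)))
  · exact IsArith.not (isArith_isNodeBranch (r := fun f _ => f 2) (z := fun f _ => f 4)
      (hreal 2) (hreal 4))
  · refine IsArith.imp (IsArith.all (IsArith.lt hz (IsArithFun.const K)))
      (IsArith.imp (isArith_isValuation (r := fun f _ => f 2) (z := fun f _ i => f 4 (2 * i))
        (E := fun f _ i => f 4 (2 * i + 1)) (hreal 2) hz hE) (IsArith.imp (IsArith.all (IsArith.ex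
          (isArith_codeMem (c := fun f (p : (Unit × ℕ) × ℕ) i =>
            f 3 (Nat.pair (Nat.pair p.1.2 p.2) i)) (z := fun f _ i => f 4 (2 * i)) hx hz)))
              (IsArith.not (IsArith.eq ?_ (IsArithFun.const 1)))))
    exact IsArithFun.apply_real 4 (IsArithFun.const _)

theorem isSigmaOneTwo_meagerMatrix (K : ℕ) : IsSigmaOneTwo fun f : Fin 3 → ℕ → ℕ =>
    ∃ x, ∀ y, MeagerMatrix K (f 0) (f 1) (f 2) x y :=
  ⟨_, (isArith_meagerMatrix K).isArithmetical, fun _ => Iff.rfl⟩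

/-- The criterion `mem_meagerIdeal_iff` in coded form. One real `y` plays three roles: a code
testing predensity, a possible branch of the tree, and a point interleaved with a valuation. These
roles may share the universal quantifier, as it distributes over conjunctions. -/
theorem exists_forall_meagerMatrix_iff {X : Type v} [Nontrivial X] [TopologicalSpace X]
    [DiscreteTopology X] {K : ℕ} (e : X ≃ Fin K) {n₀ n₁ : ℕ → ℕ} (hn : IsNormSeq n₀ n₁)
    (r : ℕ → ℕ) : (∃ x, ∀ y, MeagerMatrix K n₀ n₁ r x y) ↔
      ∃ A : Set (ℕ → X), IsBorelCode e r A ∧ A ∈ meagerIdeal (posFamily n₀ n₁ fun _ => X) := by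
  have : Finite X := Finite.of_equiv _ e.symm
  have hC : IsClosedBase (posFamily n₀ n₁ fun _ => X) := isClosedBase_posFamily hn
  have hfam := posFamily_eq_range_codeSet (n₀ := n₀) (n₁ := n₁) e
  constructor
  · rintro ⟨x, hx⟩
    obtain ⟨A, hA⟩ := (exists_isBorelCode_iff e (r := r)).2 fun y => (hx y).2.2.1
    refine ⟨A, hA, hC.mem_meagerIdeal_iff.2
      ⟨fun n j => codeSet e fun i => x (Nat.pair (Nat.pair n j) i), fun n j => ?_, ?_, ?_⟩⟩
    · rw [hfam]
      exact ⟨_, (hx 0).1 n j, rfl⟩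
    · intro B hB n
      rw [hfam] at hB
      obtain ⟨y, hy, rfl⟩ := hB
      obtain ⟨j, hj⟩ := (hx y).2.1 hy n
      exact ⟨j, (codeCompat_iff e).1 hj⟩
    · rw [disjoint_left]
      intro η hηA hη
      obtain ⟨E, hE⟩ := hA.exists_valuation η
      -- Even places carry the point, odd places its valuation.
      let y : ℕ → ℕ := fun n => if n % 2 = 0 then e (η (n / 2)) else E (n / 2)
      have hy₀ : ∀ i, y (2 * i) = e (η i) := fun i => by simp [y]
      have hy₁ : ∀ i, y (2 * i + 1) = E i := fun i => by
        have h₁ : (2 * i + 1) % 2 ≠ 0 := by omega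
        have h₂ : (2 * i + 1) / 2 = i := by omega
        simp only [y, if_neg h₁, h₂]
      have h := (hx y).2.2.2
      simp only [hy₀, hy₁] at h
      refine h (fun i => (e (η i)).2) hE (fun n => ?_) ?_
      · exact mem_iUnion.1 (mem_iInter.1 hη n)
      · exact (hE.eq_one_iff hA 0 (nodeCode_zero r) hE.1).2 hηA
  · rintro ⟨A, hA, hAI⟩
    obtain ⟨B, hB, hd, hdis⟩ := hC.mem_meagerIdeal_iff.1 hAI
    simp only [hfam] at hB
    choose c hc hcB using hB
    refine ⟨fun i => c i.unpair.1.unpair.1 i.unpair.1.unpair.2 i.unpair.2, fun y => ?_⟩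
    simp only [MeagerMatrix, Nat.unpair_pair]
    refine ⟨hc, fun hy n => ?_, (exists_isBorelCode_iff e).1 ⟨A, hA⟩ y, fun hk hE hmem h₁ => ?_⟩
    · obtain ⟨j, hj⟩ := hd (codeSet e y) (by rw [hfam]; exact ⟨y, hy, rfl⟩) n
      rw [← hcB] at hj
      exact ⟨j, (codeCompat_iff e).2 hj⟩
    · let η : ℕ → X := fun i => e.symm ⟨y (2 * i), hk i⟩
      have hη : (fun i => y (2 * i)) = fun i => ((e (η i) : Fin K) : ℕ) := by
        funext i
        simp [η]
      rw [hη] at hE hmem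
      refine disjoint_left.1 hdis
        ((hE.eq_one_iff hA 0 (nodeCode_zero r) hE.1).1 h₁) (mem_iInter.2 fun n => ?_)
      obtain ⟨j, hj⟩ := hmem n
      refine mem_iUnion.2 ⟨j, ?_⟩
      rw [← hcB]
      exact hj

end Complexity

end NormIdeal

open NormIdeal
theorem mainTheorem2 :
    (∀ (H : ℕ → Type u) [∀ i, Countable (H i)] [∀ i, Nontrivial (H i)]
        [∀ i, TopologicalSpace (H i)] [∀ i, DiscreteTopology (H i)]
        (n₀ n₁ : ℕ → ℕ), IsNormSeq n₀ n₁ →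
      -- the sets of possibilities form a category base without meager members
      (IsCategoryBase (posFamily n₀ n₁ H) ∧
        ∀ A ∈ posFamily n₀ n₁ H,
          A ∉ meagerIdeal (posFamily n₀ n₁ H)) ∧
      -- the Baire property
      ((∀ A : Set (∀ i, H i), AnalyticSet A →
          A ∈ baireSets (posFamily n₀ n₁ H)) ∧
        ∀ A ∈ baireSets (posFamily n₀ n₁ H),
          ∃ B ∈ piZero (∀ i, H i) 3, B ⊆ A ∧
            A \ B ∈ meagerIdeal (posFamily n₀ n₁ H)) ∧
      -- the ideal of meager sets
      (IsSigmaIdeal (meagerIdeal (posFamily n₀ n₁ H)) ∧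
        HasBorelBasis (meagerIdeal (posFamily n₀ n₁ H)) ∧
        IsCCC (meagerIdeal (posFamily n₀ n₁ H)) ∧
        ∀ A ∈ meagerIdeal (posFamily n₀ n₁ H),
          ∃ B ∈ meagerIdeal (posFamily n₀ n₁ H),
            B ∈ sigmaZero (∀ i, H i) 3 ∧ A ⊆ B)) ∧
    (∀ (X : Type v) [AddGroup X] [Fintype X] [Nontrivial X] [TopologicalSpace X]
        [DiscreteTopology X],
      (∀ n₀ n₁ : ℕ → ℕ, IsNormSeq n₀ n₁ →
        IsSigmaIdeal
          (meagerIdeal (posFamily n₀ n₁ (fun _ => X))) ∧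
        HasBorelBasis
          (meagerIdeal (posFamily n₀ n₁ (fun _ => X))) ∧
        IsCCC
          (meagerIdeal (posFamily n₀ n₁ (fun _ => X))) ∧
        IsTranslationInvariant
          (meagerIdeal (posFamily n₀ n₁ (fun _ => X))) ∧
        IsIndexInvariant
          (meagerIdeal (posFamily n₀ n₁ (fun _ => X))) ∧
        meagerIdeal (posFamily n₀ n₁ (fun _ => X)) ≠
          firstCategoryIdeal (ℕ → X) ∧
        meagerIdeal (posFamily n₀ n₁ (fun _ => X)) ≠
          nullIdeal X ∧
        meagerIdeal (posFamily n₀ n₁ (fun _ => X)) ≠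
          firstCategoryIdeal (ℕ → X) ∩ nullIdeal X) ∧
      -- one formula, with `n₀` and `n₁` as parameters, for membership of codes in the ideal
      ∀ (k : ℕ) (e : X ≃ Fin k), ∃ R : (Fin 3 → ℕ → ℕ) → Prop, IsSigmaOneTwo R ∧
        ∀ n₀ n₁ : ℕ → ℕ, IsNormSeq n₀ n₁ → ∀ r : ℕ → ℕ,
          (R ![n₀, n₁, r] ↔ ∃ A : Set (ℕ → X), IsBorelCode e r A ∧
            A ∈ meagerIdeal (posFamily n₀ n₁ (fun _ => X)))) := by
  refine ⟨fun H _ _ _ _ n₀ n₁ hn => ?_, fun X _ _ _ _ _ => ⟨fun n₀ n₁ hn => ?_, fun k e => ?_⟩⟩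
  · have hpol : ∀ i, PolishSpace (H i) := fun i => inferInstance
    have hC : IsClosedBase (posFamily n₀ n₁ H) := isClosedBase_posFamily hn
    exact ⟨⟨hC.isCategoryBase, fun A hA => hC.notMem_meagerIdeal hA⟩,
      ⟨fun A hA => hC.analyticSet_mem_baireSets hA, fun A hA => hC.exists_piZero_three hA⟩,
      hC.isSigmaIdeal, hC.hasBorelBasis, hC.isCCC, fun A hA => hC.exists_sigmaZero_three hA⟩
  · have hpol : PolishSpace X := inferInstance
    have hC : IsClosedBase (posFamily n₀ n₁ fun _ => X) := isClosedBase_posFamily hn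
    exact ⟨hC.isSigmaIdeal, hC.hasBorelBasis, hC.isCCC, isTranslationInvariant_meagerIdeal X,
      isIndexInvariant_meagerIdeal X hn, meagerIdeal_ne X hn⟩
  · exact ⟨_, isSigmaOneTwo_meagerMatrix k, fun n₀ n₁ hn r => exists_forall_meagerMatrix_iff e hn r⟩
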